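/- Let $k$ be a field of characteristic different from $2$ containing a square root of $-1$, and let $n\ge 1$. Let $H=K^M(k)/2\,[\tau]$ be the motivic cohomology of $\mathrm{Spec}(k)$ with $\mathbb Z/2$-coefficients ($K^M$ denotes Milnor K-theory), and let $H(BO_n)=H[u_1,\dots,u_n]$ be the motivic cohomology ring of the Nisnevich classifying space $BO_n$, presented by the subtle Stiefel–Whitney classes $u_i$ (with $u_0=1$ and $u_i=0$ for $i>n$). The motivic Steenrod operations $Sq^a$ ($a\ge 0$) act on it. In terms of the presentation they are the unique additive operations for which $Sq^0$ is the identity and $Sq^a$ is zero for $a>0$ on $H$, which satisfy the Wu formula $$Sq^a u_m=\begin{cases}\sum_{j=0}^a\binom{m+j-a-1}{j}u_{a-j}u_{m+j}, & 0\le a<m,\\ u_m^2, & a=m,\\ 0, & a>m,\end{cases}\qquad 1\le m\le n,$$ and the motivic Cartan formula $$Sq^{a}(xy)=\sum_{b+c=a}\tau^{\epsilon(b,c)}\,Sq^b(x)\,Sq^c(y),$$ where $\epsilon(b,c)=1$ if $b$ and $c$ are both odd and $\epsilon(b,c)=0$ otherwise. Let $S_n=\mathbb Z/2[u_1,\dots,u_n]$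 and let $\gamma_n:H(BO_n)\to S_n$ be the ring homomorphism that sends $u_i$ to $u_i$ and kills $\tau$ and $K^M_r(k)/2$ for all $r>0$. Define $h=h(n)$ by the following table, where $l\ge 0$: $$\begin{array}{c|cccccccc} n & 8l+1 & 8l+2 & 8l+3 & 8l+4 & 8l+5 & 8l+6 & 8l+7 & 8l+8\\ \hline h & 4l & 4l+1 & 4l+1 & 4l+1 & 4l+2 & 4l+3 & 4l+3 & 4l+3\end{array}$$ Put $\theta_0=u_2$ and $\theta_{j+1}=Sq^{2^j}\theta_j$ in $H(BO_n)$, so that $\theta_j=Sq^{2^{j-1}}\cdots Sq^2Sq^1u_2$. Then the sequence of $h+1$ elements $$\gamma_n(u_1),\ \gamma_n(\theta_0),\ \gamma_n(\theta_1),\ \dots,\ \gamma_n(\theta_{h-1}),$$ that is, $\gamma_n(u_1),\gamma_n(u_2),\gamma_n(Sq^1u_2),\dots,\gamma_n(Sq^{2^{h-2}}Sq^{2^{h-3}}\cdots Sq^1u_2)$ (only $\gamma_n(u_1)$ if $h=0$), is a regular sequence in $S_n$. -/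

import Mathlib

namespace SubtleSW

open Polynomial

/-- The relations of Milnor K-theory modulo `2`: bilinearity `{ab} = {a} + {b}` and the Steinberg
relation `{a}{b} = 0` for `a + b = 1`. -/
def milnorRelations (k : Type*) [Field k] : Set (MvPolynomial kˣ (ZMod 2)) :=
  {r | ∃ a b : kˣ, r = MvPolynomial.X (a * b) - (MvPolynomial.X a + MvPolynomial.X b)} ∪
  {r | ∃ a b : kˣ, (a : k) + (b : k) = 1 ∧ r = MvPolynomial.X a * MvPolynomial.X b}

/-- `K^M(k)/2`, Milnor K-theory of the field `k` modulo `2`. The relation `{a}{b} = -{b}{a}` of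
Milnor K-theory makes it commutative modulo `2`, so that it is the commutative `ℤ/2`-algebra
generated by the symbols `{a}`, `a ∈ kˣ`, with the relations above. -/
abbrev MilnorKMod2 (k : Type*) [Field k] : Type _ :=
  MvPolynomial kˣ (ZMod 2) ⧸ Ideal.span (milnorRelations k)

/-- The augmentation `K^M(k)/2 → K^M_0(k)/2 = ℤ/2`, which kills all symbols. -/
noncomputable def milnorAug (k : Type*) [Field k] : MilnorKMod2 k →+* ZMod 2 :=
  Ideal.Quotient.lift _ (MvPolynomial.aeval (fun _ : kˣ => (0 : ZMod 2))).toRingHom (by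
    intro r hr
    have h : Ideal.span (milnorRelations k) ≤
        RingHom.ker (MvPolynomial.aeval (fun _ : kˣ => (0 : ZMod 2))).toRingHom := by
      rw [Ideal.span_le]
      rintro r (⟨a, b, rfl⟩ | ⟨a, b, -, rfl⟩) <;> simp [RingHom.mem_ker]
    exact h hr)

/-- `H = K^M(k)/2[τ]`, the motivic cohomology with `ℤ/2`-coefficients of `Spec k`. -/
abbrev H (k : Type*) [Field k] : Type _ := (MilnorKMod2 k)[X]

/-- The generator `τ` of `H^{0,1}`. -/
noncomputable def tau (k : Type*) [Field k] : H k := X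

/-- The homomorphism `H → ℤ/2` that kills `τ` and all symbols. -/
noncomputable def augH (k : Type*) [Field k] : H k →+* ZMod 2 :=
  Polynomial.eval₂RingHom (milnorAug k) 0

/-- `H(BO_n) = H[u₁, …, uₙ]`, the motivic cohomology of `BO_n` (the variable with index `i : Fin n`
is `u_{i+1}`). -/
abbrev HBO (k : Type*) [Field k] (n : ℕ) : Type _ := MvPolynomial (Fin n) (H k)

/-- The subtle Stiefel-Whitney classes: `u₀ = 1`, `uᵢ` is the `i`-th variable for `1 ≤ i ≤ n`, and
`uᵢ = 0` for `i > n`. -/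
noncomputable def u (k : Type*) [Field k] (n i : ℕ) : HBO k n :=
  if i = 0 then 1 else if h : i - 1 < n then MvPolynomial.X ⟨i - 1, h⟩ else 0

/-- The right-hand side of the Wu formula for `Sq^a u_m`. -/
noncomputable def wu (k : Type*) [Field k] (n a m : ℕ) : HBO k n :=
  if a < m then
    ∑ j ∈ Finset.range (a + 1), ((m + j - a - 1).choose j) • (u k n (a - j) * u k n (m + j))
  else if a = m then u k n m ^ 2 else 0

/-- The ring `A[s, t]/(s² = τ t)` with `A = H(BO_n)`, which carries the values of the total Steenrod
operation `x ↦ ∑ᵢ Sq^{2i}(x) tⁱ + s ∑ᵢ Sq^{2i+1}(x) tⁱ`. It is the quadratic algebra over the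
polynomial ring `A[t]` with `s² = τ t`. Multiplicativity of the total operation is the motivic
Cartan formula (see `Sq_mul`). -/
abbrev TotalRing (k : Type*) [Field k] (n : ℕ) : Type _ :=
  QuadraticAlgebra ((HBO k n)[X]) (C (MvPolynomial.C (tau k)) * X) 0

/-- The value of the total Steenrod operation on `u_m`, given by the Wu formula. -/
noncomputable def totalGen (k : Type*) [Field k] (n m : ℕ) : TotalRing k n :=
  ⟨∑ i ∈ Finset.range (m + 1), monomial i (wu k n (2 * i) m),
   ∑ i ∈ Finset.range (m + 1), monomial i (wu k n (2 * i + 1) m)⟩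

/-- The total Steenrod operation on `H(BO_n)`: the homomorphism of `H`-algebras with the given
values on the generators. It is `H`-linear because the Steenrod operations of positive degree
vanish on `H` when `-1` is a square in `k`. -/
noncomputable def total (k : Type*) [Field k] (n : ℕ) : HBO k n →ₐ[H k] TotalRing k n :=
  MvPolynomial.aeval (fun i : Fin n => totalGen k n (i + 1))

/-- The motivic Steenrod operation `Sq^a` on `H(BO_n)` over a field that contains a square root
of `-1`: `Sq^{2i}` is the coefficient of `tⁱ` and `Sq^{2i+1}` the coefficient of `s tⁱ` in the total
operation. -/
noncomputable def Sq (k : Type*) [Field k] (n a : ℕ) (x : HBO k n) : HBO k n :=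
  if Even a then (total k n x).re.coeff (a / 2) else (total k n x).im.coeff (a / 2)

/-! The operations `Sq` are additive, act trivially on `H`, and satisfy the Wu formula and the
motivic Cartan formula (over a field in which `-1` is a square, so that the class `ρ` of `-1`
vanishes); they are the only operations that do so. -/

section Properties

variable (k : Type*) [Field k] (n : ℕ)

/-- The class `ρ` of `-1` vanishes if `-1` is a square. -/
theorem rho_eq_zero (hk : IsSquare (-1 : k)) :
    (Ideal.Quotient.mk (Ideal.span (milnorRelations k)) (MvPolynomial.X (-1 : kˣ))) = 0 := by
  obtain ⟨b, hb⟩ := hk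
  have hb0 : b ≠ 0 := by
    rintro rfl
    simp at hb
  have h1 : (-1 : kˣ) = Units.mk0 b hb0 * Units.mk0 b hb0 := by
    ext
    simpa using hb
  rw [Ideal.Quotient.eq_zero_iff_mem, h1]
  apply Ideal.subset_span
  left
  exact ⟨Units.mk0 b hb0, Units.mk0 b hb0, by rw [CharTwo.add_self_eq_zero, sub_zero]⟩

theorem Sq_even (i : ℕ) (x : HBO k n) : Sq k n (2 * i) x = (total k n x).re.coeff i := by
  simp [Sq]

theorem Sq_odd (i : ℕ) (x : HBO k n) : Sq k n (2 * i + 1) x = (total k n x).im.coeff i := by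
  have h : (2 * i + 1) / 2 = i := by omega
  simp [Sq, h]

theorem Sq_add (a : ℕ) (x y : HBO k n) : Sq k n a (x + y) = Sq k n a x + Sq k n a y := by
  unfold Sq
  split <;> simp

theorem total_C (c : H k) : total k n (MvPolynomial.C c) = ⟨C (MvPolynomial.C c), 0⟩ :=
  (total k n).commutes c

/-- The Steenrod operations act trivially on `H`. -/
theorem Sq_C (a : ℕ) (c : H k) :
    Sq k n a (MvPolynomial.C c) = if a = 0 then MvPolynomial.C c else 0 := by
  rcases Nat.even_or_odd' a with ⟨i, rfl | rfl⟩
  · rw [Sq_even, total_C]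
    simp [Polynomial.coeff_C]
  · rw [Sq_odd, total_C]
    simp

theorem wu_eq_zero {a m : ℕ} (h : m < a) : wu k n a m = 0 := by
  simp [wu, not_lt.mpr h.le, h.ne']

/-- The Wu formula. -/
theorem Sq_u (a m : ℕ) (hm : 1 ≤ m) (hmn : m ≤ n) : Sq k n a (u k n m) = wu k n a m := by
  have hu : total k n (u k n m) = totalGen k n m := by
    have h0 : m ≠ 0 := by omega
    have h1 : m - 1 < n := by omega
    have h2 : m - 1 + 1 = m := by omega
    simp [u, h0, h1, total, h2]
  rcases Nat.even_or_odd' a with ⟨i, rfl | rfl⟩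
  · rw [Sq_even, hu]
    simp only [totalGen, finsetSum_coeff, coeff_monomial, Finset.sum_ite_eq',
      Finset.mem_range]
    split_ifs with h
    · rfl
    · exact (wu_eq_zero k n (by omega)).symm
  · rw [Sq_odd, hu]
    simp only [totalGen, finsetSum_coeff, coeff_monomial, Finset.sum_ite_eq',
      Finset.mem_range]
    split_ifs with h
    · rfl
    · exact (wu_eq_zero k n (by omega)).symm

/-- The motivic Cartan formula for `ρ = 0`. -/
def IsCartan (T : ℕ → HBO k n → HBO k n) : Prop :=
  ∀ (i : ℕ) (x y : HBO k n),
    T (2 * i) (x * y) =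
      ∑ j ∈ Finset.range (i + 1), T (2 * j) x * T (2 * (i - j)) y +
      MvPolynomial.C (tau k) *
        ∑ j ∈ Finset.range i, T (2 * j + 1) x * T (2 * (i - 1 - j) + 1) y ∧
    T (2 * i + 1) (x * y) =
      ∑ j ∈ Finset.range (i + 1),
        (T (2 * j) x * T (2 * (i - j) + 1) y + T (2 * j + 1) x * T (2 * (i - j)) y)

/-- The motivic Cartan formula holds for `Sq`. -/
theorem Sq_mul : IsCartan k n (Sq k n) := by
  intro i x y
  constructor
  · have h : ∀ f g : (HBO k n)[X],
        (C (MvPolynomial.C (tau k)) * X * f * g).coeff i =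
          MvPolynomial.C (tau k) * ∑ j ∈ Finset.range i, f.coeff j * g.coeff (i - 1 - j) := by
      intro f g
      rw [mul_assoc, mul_assoc, Polynomial.coeff_C_mul]
      cases i with
      | zero => simp
      | succ i =>
        rw [Polynomial.coeff_X_mul, Polynomial.coeff_mul,
          Finset.Nat.sum_antidiagonal_eq_sum_range_succ_mk]
        simp
    simp only [Sq_even, Sq_odd, map_mul, QuadraticAlgebra.re_mul, Polynomial.coeff_add, h]
    rw [Polynomial.coeff_mul, Finset.Nat.sum_antidiagonal_eq_sum_range_succ_mk]
  · simp only [Sq_even, Sq_odd, map_mul, QuadraticAlgebra.im_mul, Polynomial.coeff_add, zero_mul,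
      add_zero, Polynomial.coeff_mul, Finset.Nat.sum_antidiagonal_eq_sum_range_succ_mk,
      Finset.sum_add_distrib]

theorem u_succ (i : Fin n) : u k n (i + 1) = MvPolynomial.X i := by
  simp [u]

/-- `Sq^0` is the identity. -/
theorem Sq_zero (x : HBO k n) : Sq k n 0 x = x := by
  induction x using MvPolynomial.induction_on with
  | C c => simp [Sq_C]
  | add p q hp hq => rw [Sq_add, hp, hq]
  | mul_X p i hp =>
    have h := (Sq_mul k n 0 p (MvPolynomial.X i)).1
    have h2 : Sq k n 0 (u k n (i + 1)) = u k n (i + 1) := by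
      rw [Sq_u k n 0 (i + 1) (by omega) (by omega)]
      have h0 : u k n 0 = 1 := by simp [u]
      simp [wu, h0]
    rw [u_succ] at h2
    simpa [hp, h2] using h

/-- The Steenrod operations on `H(BO_n)` are determined by additivity, their triviality on `H`, the
Cartan formula and the Wu formula. -/
theorem Sq_unique (T : ℕ → HBO k n → HBO k n)
    (hadd : ∀ a x y, T a (x + y) = T a x + T a y)
    (hC : ∀ a c, T a (MvPolynomial.C c) = if a = 0 then MvPolynomial.C c else 0)
    (hwu : ∀ a m, 1 ≤ m → m ≤ n → T a (u k n m) = wu k n a m)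
    (hmul : IsCartan k n T) : T = Sq k n := by
  funext a x
  induction x using MvPolynomial.induction_on generalizing a with
  | C c => rw [hC, Sq_C]
  | add p q hp hq => rw [hadd, Sq_add, hp, hq]
  | mul_X p i hp =>
    have hX : ∀ b, T b (MvPolynomial.X i) = Sq k n b (MvPolynomial.X i) := by
      intro b
      rw [← u_succ, hwu b _ (by omega) (by omega), Sq_u k n b _ (by omega) (by omega)]
    rcases Nat.even_or_odd' a with ⟨j, rfl | rfl⟩
    · rw [(hmul _ _ _).1, (Sq_mul k n _ _ _).1]
      simp only [hp, hX]
    · rw [(hmul _ _ _).2, (Sq_mul k n _ _ _).2]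
      simp only [hp, hX]

end Properties

/-- `S_n = ℤ/2[u₁, …, uₙ]` (the variable with index `i : Fin n` is `u_{i+1}`). -/
abbrev S (n : ℕ) : Type := MvPolynomial (Fin n) (ZMod 2)

/-- The ring homomorphism `γ_n : H(BO_n) → S_n` induced by `H → ℤ/2`, with `uᵢ ↦ uᵢ`. -/
noncomputable def gamma (k : Type*) [Field k] (n : ℕ) : HBO k n →+* S n :=
  MvPolynomial.map (augH k)

/-- `theta j = Sq^{2^{j-1}} ⋯ Sq^2 Sq^1 u₂`. -/
noncomputable def theta (k : Type*) [Field k] (n : ℕ) : ℕ → HBO k n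
  | 0 => u k n 2
  | j + 1 => Sq k n (2 ^ j) (theta k n j)

/-- The table of the values `h(n)` for `n ≥ 1`: write `n = 8 l + r` with `1 ≤ r ≤ 8`. -/
def hTable (n : ℕ) : ℕ :=
  match (n - 1) % 8 with
  | 0 => 4 * ((n - 1) / 8)
  | 1 => 4 * ((n - 1) / 8) + 1
  | 2 => 4 * ((n - 1) / 8) + 1
  | 3 => 4 * ((n - 1) / 8) + 1
  | 4 => 4 * ((n - 1) / 8) + 2
  | 5 => 4 * ((n - 1) / 8) + 3
  | 6 => 4 * ((n - 1) / 8) + 3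
  | _ => 4 * ((n - 1) / 8) + 3

end SubtleSW

/-!
Over `ℤ/2` the classes `γ_n(θ_j)` are identified explicitly, and regularity is then a statement on
dimensions.

*Identification of the classes.* Modulo `τ` and the symbols the Cartan formula for the even
operations `Sq^{2i}` has no odd terms, so `x ↦ ∑ᵢ Sq^{2i}(x) tⁱ` induces a ring homomorphism on `S_n`
(`evenTotal`). Let `c(w) = ∑ u_{2m} w^m`, `d(w) = ∑ u_{2m+1} w^m` and `p = d / c`. Put
`C(ζ) = ∑_{m,i} Sq^{2i}(u_{2m}) tⁱ ζ^{m+i}` and define `D`, `Q` in the same way from `d`, `p`. With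
the roots `α, β` of `T² + T + t`, the Wu formula says that `C(ζ) = c(αζ) c(βζ)` and
`D(ζ) = α d(αζ) c(βζ) + β d(βζ) c(αζ)`, whence `Q(ζ) = α p(αζ) + β p(βζ)`. Comparing coefficients
gives `Sq^{2i} p_k = binom(k, i) p_{k+i}` (`coeff_evenTotal_pSeries`), and by induction
`γ_n(θ_{j+1}) = p_{2^j}` (`gamma_theta_succ`).

*Regularity from dimensions.* Since polynomial rings over fields are Cohen-Macaulay, a sequence is
weakly regular as soon as all primes that contain its first `i` terms have codimension at least
`i` (`isWeaklyRegular_of_trdeg_le`). This is derived from Rees' exchange property: if the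
localization of a prime `P` at the nonzero polynomials in a transcendence basis of variables has
depth at least the codimension of `P`, then `P` is not associated to a shorter regular sequence.

*The dimension estimate.* On the residue field of a prime that contains `u_1 = p_0`, `u_2 = c_1`
and `p_{2^j}` for `j < N`, the sequence `p_r` satisfies the linear recurrence with characteristic
polynomial `F = T^M + c_1 T^{M-1} + ⋯ + c_m T^{M-m}`, where `m = ⌊n/2⌋` and `M = ⌈n/2⌉`, and
`T^r ↦ p_r` is a linear functional on the algebra `L[T] ⧸ (F)`, where `L` is generated by the `c_i`. It
vanishes on `1, T, T², …, T^{2^{N-1}}`. If these elements are independent, the `p_r` span an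
`L`-space of dimension at most `M - N - 1`, as required. Otherwise `F` divides a polynomial
`T^{2^e} + ∑_{j<e} a_j T^{2^j} + b` with `e < N`, so that the `c_i` are algebraic over the `e + 1`
coefficients `a_j, b`, and the loss of dimension in `p` is made up for by the `c_i`. In the
extreme cases of the table one further dimension is gained from `b = 0`: either `T` divides `F`,
or the degree of `F` is odd and the polynomial is summed over the roots of `F`, whose sum is
`c_1 = 0` (`affinePoly_const_eq_zero_of_odd`). The resulting bound is `trdeg_le_of_vanishing`.
-/

open Polynomial

namespace SubtleSW

/-! ### Depth relative to an ideal -/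

section Depth

variable {R : Type*} [CommRing R]

/-- `a` is a nonzerodivisor on `R ⧸ J`. -/
def RegMod (J : Ideal R) (a : R) : Prop := ∀ x, a * x ∈ J → x ∈ J

/-- `DepthGE I J r`: there are `r` elements of `I` that form a regular sequence on `R ⧸ J` (possibly
with zero quotient). -/
inductive DepthGE (I : Ideal R) : Ideal R → ℕ → Prop
  | zero (J : Ideal R) : DepthGE I J 0
  | succ {J : Ideal R} {r : ℕ} (a : R) (ha : a ∈ I) (hreg : RegMod J a)
      (h : DepthGE I (J ⊔ Ideal.span {a}) r) : DepthGE I J (r + 1)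

/-- No nonzero element of `R ⧸ J` is killed by `I`. -/
def NoSocle (I J : Ideal R) : Prop := ∀ x, (∀ c ∈ I, c * x ∈ J) → x ∈ J

theorem RegMod.noSocle {I J : Ideal R} {a : R} (h : RegMod J a) (ha : a ∈ I) : NoSocle I J :=
  fun x hx => h x (hx a ha)

theorem mem_sup_span_singleton {J : Ideal R} {a x : R} :
    x ∈ J ⊔ Ideal.span {a} ↔ ∃ y, x - a * y ∈ J := by
  rw [sup_comm, Ideal.mem_span_singleton_sup]
  constructor
  · rintro ⟨y, j, hj, rfl⟩
    exact ⟨y, by simpa [mul_comm a y] using hj⟩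
  · rintro ⟨y, hy⟩
    exact ⟨y, _, hy, by ring⟩

theorem mem_associatedPrimes_quotient_iff [IsNoetherianRing R] {J P : Ideal R} :
    P ∈ associatedPrimes R (R ⧸ J) ↔ P.IsPrime ∧ ∃ w, ∀ c, c ∈ P ↔ c * w ∈ J := by
  have key : ∀ c w : R, c ∈ Submodule.colon (⊥ : Submodule R (R ⧸ J)) {Ideal.Quotient.mk J w} ↔
      c * w ∈ J := by
    intro c w
    rw [Submodule.mem_colon_singleton, Submodule.mem_bot, ← Ideal.Quotient.eq_zero_iff_mem, map_mul]
    rfl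
  rw [AssociatedPrimes.mem_iff, isAssociatedPrime_iff]
  refine and_congr_right fun _ => ⟨?_, ?_⟩
  · rintro ⟨x, rfl⟩
    obtain ⟨w, rfl⟩ := Ideal.Quotient.mk_surjective x
    exact ⟨w, fun c => key c w⟩
  · rintro ⟨w, hw⟩
    exact ⟨Ideal.Quotient.mk J w, Ideal.ext fun c => (hw c).trans (key c w).symm⟩

theorem exists_associatedPrime_of_not_regMod [IsNoetherianRing R] {J : Ideal R} {a : R}
    (h : ¬ RegMod J a) : ∃ P ∈ associatedPrimes R (R ⧸ J), a ∈ P := by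
  unfold RegMod at h
  push Not at h
  obtain ⟨x, hx, hxJ⟩ := h
  have h1 : a ∈ ⋃ p ∈ associatedPrimes R (R ⧸ J), (p : Set R) := by
    rw [biUnion_associatedPrimes_eq_zero_divisors]
    refine ⟨Ideal.Quotient.mk J x, by rwa [Ne, Ideal.Quotient.eq_zero_iff_mem], ?_⟩
    rw [← Ideal.Quotient.eq_zero_iff_mem, map_mul] at hx
    exact hx
  simpa using h1

/-- Prime avoidance: an ideal that kills no nonzero element of finitely many quotients contains a
common nonzerodivisor on them. -/
theorem exists_regMod [IsNoetherianRing R] {I : Ideal R} {s : Set (Ideal R)} (hs : s.Finite)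
    (h : ∀ J ∈ s, NoSocle I J) : ∃ c ∈ I, ∀ J ∈ s, RegMod J c := by
  by_contra! hcon
  have hfin : (⋃ J ∈ s, associatedPrimes R (R ⧸ J)).Finite :=
    hs.biUnion fun J _ => associatedPrimes.finite R (R ⧸ J)
  have hsub : (I : Set R) ⊆ ⋃ P ∈ ⋃ J ∈ s, associatedPrimes R (R ⧸ J), (id P : Ideal R) := by
    intro c hc
    obtain ⟨J, hJ, hJc⟩ := hcon c hc
    obtain ⟨P, hP, hcP⟩ := exists_associatedPrime_of_not_regMod hJc
    exact Set.mem_biUnion (Set.mem_biUnion hJ hP) hcP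
  rw [Ideal.subset_union_prime_finite hfin (f := id) ⊥ ⊥] at hsub
  · obtain ⟨P, hP, hIP⟩ := hsub
    obtain ⟨J, hJ, hPJ⟩ := Set.mem_iUnion₂.mp hP
    obtain ⟨hprime, w, hw⟩ := mem_associatedPrimes_quotient_iff.mp hPJ
    have hwJ : w ∈ J := h J hJ w fun c hc => (hw c).mp (hIP hc)
    exact hprime.ne_top ((Ideal.eq_top_iff_one _).mpr ((hw 1).mpr (by simpa using hwJ)))
  · intro P hP _ _
    obtain ⟨J, hJ, hPJ⟩ := Set.mem_iUnion₂.mp hP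
    exact (mem_associatedPrimes_quotient_iff.mp hPJ).1

/-- If `a, c` is a regular sequence on `R ⧸ J`, then `a` is regular on `R ⧸ (J + (c))`. -/
theorem RegMod.swap {J : Ideal R} {a c : R} (ha : RegMod J a)
    (hc : RegMod (J ⊔ Ideal.span {a}) c) : RegMod (J ⊔ Ideal.span {c}) a := by
  intro x hx
  obtain ⟨y, hy⟩ := mem_sup_span_singleton.mp hx
  have h1 : c * y ∈ J ⊔ Ideal.span {a} :=
    mem_sup_span_singleton.mpr ⟨x, by rw [← neg_sub]; exact neg_mem hy⟩
  obtain ⟨z, hz⟩ := mem_sup_span_singleton.mp (hc y h1)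
  refine mem_sup_span_singleton.mpr ⟨z, ha _ ?_⟩
  have : a * (x - c * z) = (a * x - c * y) + c * (y - a * z) := by ring
  rw [this]
  exact add_mem hy (J.mul_mem_left c hz)

/-- Rees' exchange argument: the socles of `R ⧸ (J + (a))` and `R ⧸ (J + (b))` vanish
simultaneously if `a, b ∈ I` are regular on `R ⧸ J`. -/
theorem NoSocle.exchange {I J : Ideal R} {a b : R} (h : NoSocle I (J ⊔ Ideal.span {a}))
    (haI : a ∈ I) (ha : RegMod J a) (hb : RegMod J b) :
    NoSocle I (J ⊔ Ideal.span {b}) := by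
  intro x hx
  obtain ⟨y, hy⟩ := mem_sup_span_singleton.mp (hx a haI)
  have hyJ : y ∈ J ⊔ Ideal.span {a} := by
    refine h y fun c hc => ?_
    obtain ⟨z, hz⟩ := mem_sup_span_singleton.mp (hx c hc)
    refine mem_sup_span_singleton.mpr ⟨z, hb _ ?_⟩
    have : b * (c * y - a * z) = a * (c * x - b * z) - c * (a * x - b * y) := by ring
    rw [this]
    exact sub_mem (J.mul_mem_left a hz) (J.mul_mem_left c hy)
  obtain ⟨w, hw⟩ := mem_sup_span_singleton.mp hyJ
  refine mem_sup_span_singleton.mpr ⟨w, ha _ ?_⟩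
  have : a * (x - b * w) = (a * x - b * y) + b * (y - a * w) := by ring
  rw [this]
  exact add_mem hy (J.mul_mem_left b hw)

/-- Dividing by a regular element of `I` lowers the depth by at most one, whichever element it is. -/
theorem DepthGE.sup_span_singleton [IsNoetherianRing R] {I : Ideal R} {r : ℕ} :
    ∀ {J : Ideal R} {b : R}, DepthGE I J (r + 1) → b ∈ I → RegMod J b →
      DepthGE I (J ⊔ Ideal.span {b}) r := by
  induction r with
  | zero => exact fun _ _ _ => .zero _
  | succ r ih =>
    intro J b h hbI hb
    obtain _ | ⟨a, haI, ha, h⟩ := h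
    have hsa : NoSocle I (J ⊔ Ideal.span {a}) := by
      obtain _ | ⟨a', ha'I, ha', -⟩ := h
      exact ha'.noSocle ha'I
    -- an element `c` that continues both `a` and `b` to regular sequences
    obtain ⟨c, hcI, hc⟩ := exists_regMod (I := I)
      (s := {J ⊔ Ideal.span {a}, J ⊔ Ideal.span {b}}) (by simp) (by
        rintro K (rfl | rfl)
        · exact hsa
        · exact hsa.exchange haI ha hb)
    have hca := hc _ (Set.mem_insert _ _)
    have hcb := hc _ (Set.mem_insert_of_mem _ rfl)
    have h1 : DepthGE I (J ⊔ Ideal.span {c}) (r + 1) := by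
      refine .succ a haI (ha.swap hca) ?_
      rw [sup_right_comm]
      exact ih h hcI hca
    refine .succ c hcI hcb ?_
    rw [sup_right_comm]
    exact ih h1 hbI (hb.swap hcb)

/-- `fs` is a weakly regular sequence on `R ⧸ J`. -/
def RegSeqMod : Ideal R → List R → Prop
  | _, [] => True
  | J, f :: fs => RegMod J f ∧ RegSeqMod (J ⊔ Ideal.span {f}) fs

theorem RegSeqMod.concat {fs : List R} {f : R} : ∀ {J : Ideal R}, RegSeqMod J fs →
    RegMod (J ⊔ Ideal.ofList fs) f → RegSeqMod J (fs ++ [f]) := by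
  induction fs with
  | nil => exact fun _ h => ⟨by simpa using h, trivial⟩
  | cons g fs ih =>
    intro J h hf
    refine ⟨h.1, ih h.2 ?_⟩
    rwa [Ideal.ofList_cons, ← sup_assoc] at hf

theorem DepthGE.sup_ofList [IsNoetherianRing R] {I : Ideal R} {r : ℕ} {fs : List R} :
    ∀ {J : Ideal R}, DepthGE I J (r + fs.length) → RegSeqMod J fs → (∀ f ∈ fs, f ∈ I) →
      DepthGE I (J ⊔ Ideal.ofList fs) r := by
  induction fs with
  | nil => intro J h _ _; simpa using h
  | cons f fs ih =>
    intro J h hreg hfs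
    rw [Ideal.ofList_cons, ← sup_assoc]
    exact ih (DepthGE.sup_span_singleton (by simpa [add_assoc] using h)
      (hfs f (by simp)) hreg.1) hreg.2 fun g hg => hfs g (by simp [hg])

/-- A regular sequence in `I` that is shorter than the depth leaves no socle. -/
theorem DepthGE.noSocle [IsNoetherianRing R] {I J : Ideal R} {r : ℕ} {fs : List R}
    (h : DepthGE I J r) (hr : fs.length < r) (hreg : RegSeqMod J fs) (hfs : ∀ f ∈ fs, f ∈ I) :
    NoSocle I (J ⊔ Ideal.ofList fs) := by
  obtain ⟨t, rfl⟩ : ∃ t, r = t + 1 + fs.length := ⟨r - fs.length - 1, by omega⟩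
  obtain _ | ⟨a, haI, ha, -⟩ := h.sup_ofList hreg hfs
  exact ha.noSocle haI

theorem DepthGE.of_ringEquiv {R' : Type*} [CommRing R'] (e : R ≃+* R') {I J : Ideal R} {r : ℕ}
    (h : DepthGE I J r) : DepthGE (I.map e) (J.map e) r := by
  induction h with
  | zero => exact .zero _
  | succ a ha hreg _ ih =>
    refine .succ (e a) (Ideal.mem_map_of_mem e ha) ?_ ?_
    · intro x hx
      obtain ⟨x, rfl⟩ := e.surjective x
      rw [← map_mul, Ideal.mem_map_of_equiv] at hx
      obtain ⟨y, hy, hyx⟩ := hx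
      rw [e.injective hyx] at hy
      exact Ideal.mem_map_of_mem e (hreg x hy)
    · rw [Ideal.map_sup, Ideal.map_span, Set.image_singleton] at ih
      exact ih

theorem DepthGE.mono {I I' J : Ideal R} {r : ℕ} (h : DepthGE I J r) (hI : I ≤ I') :
    DepthGE I' J r := by
  induction h with
  | zero => exact .zero _
  | succ a ha hreg _ ih => exact .succ a (hI ha) hreg ih

theorem regMod_map_C_of_monic (J : Ideal R) {g : R[X]} (hg : g.Monic) :
    RegMod (J.map (C : R →+* R[X])) g := by
  intro x hx
  have key : ∀ y : R[X], y ∈ J.map (C : R →+* R[X]) ↔ y.map (Ideal.Quotient.mk J) = 0 := by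
    intro y
    rw [Ideal.mem_map_C_iff, Polynomial.ext_iff]
    simp [Ideal.Quotient.eq_zero_iff_mem]
  rw [key, Polynomial.map_mul] at hx
  rw [key]
  by_contra hne
  exact ((hg.map _).mul_right_ne_zero hne) hx

/-- Depth grows by one under adjoining a variable if the ideal contains a monic polynomial in it. -/
theorem DepthGE.polynomial {I J : Ideal R} {r : ℕ} (h : DepthGE I J r) {I' : Ideal R[X]}
    (hI : I.map C ≤ I') {g : R[X]} (hg : g.Monic) (hgI : g ∈ I') :
    DepthGE I' (J.map C) (r + 1) := by
  induction h with
  | zero J => exact .succ g hgI (regMod_map_C_of_monic J hg) (.zero _)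
  | succ a ha hreg _ ih =>
    refine .succ (C a) (hI (Ideal.mem_map_of_mem C ha)) ?_ ?_
    · intro x hx
      rw [Ideal.mem_map_C_iff] at hx ⊢
      intro n
      exact hreg _ (by simpa using hx n)
    · rw [Ideal.map_sup, Ideal.map_span, Set.image_singleton] at ih
      exact ih

/-- An ideal of `K[X_σ]` that contains a monic polynomial in each single variable has depth at
least the number of variables. -/
theorem depthGE_mvPolynomial (K : Type*) [Field K] (σ : Type*) [Finite σ] :
    ∀ I : Ideal (MvPolynomial σ K),
      (∀ j, ∃ g : K[X], g.Monic ∧ aeval (MvPolynomial.X j : MvPolynomial σ K) g ∈ I) →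
      DepthGE I ⊥ (Nat.card σ) := by
  induction σ using Finite.induction_empty_option with
  | @of_equiv α β e ih =>
    intro I hI
    let E : MvPolynomial α K ≃ₐ[K] MvPolynomial β K := MvPolynomial.renameEquiv K e
    have h := ih (I.comap (E : MvPolynomial α K →+* MvPolynomial β K)) (by
      intro j
      obtain ⟨g, hg, hgI⟩ := hI (e j)
      refine ⟨g, hg, ?_⟩
      rw [Ideal.mem_comap]
      have : E (aeval (MvPolynomial.X j) g) = aeval (MvPolynomial.X (e j)) g := by
        rw [← Polynomial.aeval_algHom_apply]; simp [E]
      simpa [this] using hgI)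
    have h2 := h.of_ringEquiv E.toRingEquiv
    rw [Nat.card_congr e] at h2
    rw [Ideal.map_bot] at h2
    refine h2.mono ?_
    exact Ideal.map_comap_le
  | h_empty => intro I _; simpa using DepthGE.zero _
  | @h_option α _ ih =>
    intro I hI
    let E : MvPolynomial (Option α) K ≃ₐ[K] (MvPolynomial α K)[X] :=
      MvPolynomial.optionEquivLeft K α
    let I₁ : Ideal (MvPolynomial α K)[X] := I.comap (E.symm : _ →+* _)
    obtain ⟨g₀, hg₀, hg₀I⟩ := hI none
    have h := ih (I₁.comap C) (by
      intro j
      obtain ⟨g, hg, hgI⟩ := hI (some j)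
      refine ⟨g, hg, ?_⟩
      rw [Ideal.mem_comap, Ideal.mem_comap]
      have : E (aeval (MvPolynomial.X (some j)) g) = C (aeval (MvPolynomial.X j) g) := by
        rw [← Polynomial.aeval_algHom_apply]
        simp only [E, MvPolynomial.optionEquivLeft_X_some]
        exact Polynomial.aeval_algHom_apply (IsScalarTower.toAlgHom K (MvPolynomial α K) _) _ _
      rw [← this]
      simpa using hgI)
    have h2 := h.polynomial (I' := I₁) Ideal.map_comap_le
      (g := g₀.map (algebraMap K (MvPolynomial α K))) (hg₀.map _) (by
        rw [Ideal.mem_comap]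
        have : E (aeval (MvPolynomial.X none) g₀) = g₀.map (algebraMap K (MvPolynomial α K)) := by
          rw [← Polynomial.aeval_algHom_apply]
          simp only [E, MvPolynomial.optionEquivLeft_X_none]
          rw [← Polynomial.aeval_map_algebraMap (MvPolynomial α K), Polynomial.aeval_X_left_apply]
        rw [← this]
        simpa using hg₀I)
    have h3 := h2.of_ringEquiv E.symm.toRingEquiv
    rw [Ideal.map_bot, Ideal.map_bot] at h3
    rw [Finite.card_option]
    exact h3.mono Ideal.map_comap_le

end Depth

/-! ### A transcendence degree criterion for regular sequences of polynomials -/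

section Criterion

theorem RegSeqMod.localization {R R' : Type*} [CommRing R] [CommRing R'] [Algebra R R']
    (M : Submonoid R) [IsLocalization M R'] {fs : List R} :
    ∀ {J : Ideal R}, RegSeqMod J fs →
      RegSeqMod (J.map (algebraMap R R')) (fs.map (algebraMap R R')) := by
  induction fs with
  | nil => exact fun _ => trivial
  | cons f fs ih =>
    intro J h
    refine ⟨?_, ?_⟩
    · intro x hx
      obtain ⟨y, s, rfl⟩ := IsLocalization.exists_mk'_eq M x
      have h1 : algebraMap R R' (f * y) ∈ J.map (algebraMap R R') := by
        have := Ideal.mul_mem_right (algebraMap R R' s) _ hx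
        rwa [mul_assoc, IsLocalization.mk'_spec, ← map_mul] at this
      rw [IsLocalization.algebraMap_mem_map_algebraMap_iff M] at h1
      obtain ⟨m, hm, hmy⟩ := h1
      rw [IsLocalization.mk'_mem_map_algebraMap_iff]
      exact ⟨m, hm, h.1 _ (by rwa [mul_left_comm])⟩
    · have := ih h.2
      rwa [Ideal.map_sup, Ideal.map_span, Set.image_singleton] at this

/-- If an associated prime `P` of a regular sequence `fs` becomes, in some localization away from
`P`, an ideal of depth at least `r`, then `fs` has length at least `r`. -/
theorem le_length_of_associatedPrime {R R' : Type*} [CommRing R] [CommRing R'] [Algebra R R']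
    [IsNoetherianRing R'] (M : Submonoid R) [IsLocalization M R'] {fs : List R}
    (hreg : RegSeqMod ⊥ fs) {P : Ideal R} (hMP : ∀ m ∈ M, m ∉ P) {w : R}
    (hw : ∀ c, c ∈ P ↔ c * w ∈ Ideal.ofList fs) {r : ℕ}
    (hP : DepthGE (P.map (algebraMap R R')) ⊥ r) : r ≤ fs.length := by
  by_contra! hlt
  have hfsP : ∀ f ∈ fs, f ∈ P := fun f hf =>
    (hw f).mpr (Ideal.mul_mem_right _ _ (Ideal.subset_span hf))
  have h := hP.noSocle (fs := fs.map (algebraMap R R')) (by simpa using hlt)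
    (by simpa using hreg.localization (R' := R') M) (by
      intro f hf
      obtain ⟨g, hg, rfl⟩ := List.mem_map.mp hf
      exact Ideal.mem_map_of_mem _ (hfsP g hg))
  rw [bot_sup_eq, ← Ideal.map_ofList] at h
  have hw2 := h (algebraMap R R' w) (by
    intro c hc
    have : P.map (algebraMap R R') ≤
        ((Ideal.ofList fs).map (algebraMap R R')).colon {algebraMap R R' w} := by
      rw [Ideal.map_le_iff_le_comap]
      intro c hc
      rw [Ideal.mem_comap, Submodule.mem_colon_singleton, smul_eq_mul, ← map_mul]
      exact Ideal.mem_map_of_mem _ ((hw c).mp hc)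
    simpa [Submodule.mem_colon_singleton] using this hc)
  rw [IsLocalization.algebraMap_mem_map_algebraMap_iff M] at hw2
  obtain ⟨m, hm, hmw⟩ := hw2
  exact hMP m hm ((hw m).mpr hmw)

variable {k : Type*} [Field k] {n : ℕ}

/-- The variables contain a transcendence basis of the quotient by a prime ideal. -/
theorem exists_isTranscendenceBasis_vars (P : Ideal (MvPolynomial (Fin n) k)) [P.IsPrime] :
    ∃ B : Set (Fin n), IsTranscendenceBasis k
      (fun b : B => Ideal.Quotient.mk P (MvPolynomial.X (b : Fin n))) := by
  let x : Fin n → MvPolynomial (Fin n) k ⧸ P := fun i => Ideal.Quotient.mk P (MvPolynomial.X i)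
  have htop : Algebra.adjoin k (Set.range x) = ⊤ := by
    have : Set.range x = (Ideal.Quotient.mkₐ k P) '' Set.range MvPolynomial.X := by
      rw [← Set.range_comp]; rfl
    rw [this, ← AlgHom.map_adjoin, MvPolynomial.adjoin_range_X, Algebra.map_top,
      AlgHom.range_eq_top]
    exact Ideal.Quotient.mkₐ_surjective k P
  have : Algebra.IsAlgebraic (Algebra.adjoin k (Set.range x)) (MvPolynomial (Fin n) k ⧸ P) := by
    rw [htop]
    exact ⟨fun y => isAlgebraic_algebraMap (⟨y, trivial⟩ : (⊤ : Subalgebra k _))⟩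
  obtain ⟨t, ht, hb⟩ := exists_isTranscendenceBasis_subset (R := k) (Set.range x)
  rw [← Set.image_univ] at ht
  obtain ⟨B, -, hB⟩ := Set.SurjOn.exists_bijOn_subset ht
  refine ⟨B, ?_⟩
  have := (isTranscendenceBasis_equiv (R := k) hB.equiv).mpr hb
  exact this

theorem mk_rename (P : Ideal (MvPolynomial (Fin n) k)) {B : Set (Fin n)} (a : MvPolynomial B k) :
    Ideal.Quotient.mk P (MvPolynomial.rename (↑) a) =
      MvPolynomial.aeval (fun b : B => Ideal.Quotient.mk P (MvPolynomial.X (b : Fin n))) a := by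
  have : (Ideal.Quotient.mkₐ k P).comp (MvPolynomial.rename (↑)) =
      MvPolynomial.aeval (fun b : B => Ideal.Quotient.mk P (MvPolynomial.X (b : Fin n))) :=
    MvPolynomial.algHom_ext fun b => by simp
  exact DFunLike.congr_fun this a

/-- Modulo `P`, each variable is algebraic over the variables of a transcendence basis. -/
theorem exists_eval₂_mem_of_isTranscendenceBasis (P : Ideal (MvPolynomial (Fin n) k)) [P.IsPrime]
    {B : Set (Fin n)} (hB : IsTranscendenceBasis k
      (fun b : B => Ideal.Quotient.mk P (MvPolynomial.X (b : Fin n)))) (j : Fin n) :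
    ∃ p : (MvPolynomial B k)[X], p ≠ 0 ∧
      p.eval₂ (MvPolynomial.rename (↑) : MvPolynomial B k →ₐ[k] MvPolynomial (Fin n) k).toRingHom
        (MvPolynomial.X j) ∈ P := by
  have := hB.isAlgebraic
  obtain ⟨p, hp, hpj⟩ := this.isAlgebraic (Ideal.Quotient.mk P (MvPolynomial.X j))
  let E := hB.1.aevalEquiv
  refine ⟨p.map (E.symm : _ →+* MvPolynomial B k), ?_, ?_⟩
  · rwa [Ne, Polynomial.map_eq_zero_iff E.symm.injective]
  · rw [← Ideal.Quotient.eq_zero_iff_mem, Polynomial.hom_eval₂, Polynomial.eval₂_map]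
    rw [Polynomial.aeval_def] at hpj
    convert! hpj using 2
    refine RingHom.ext fun a => ?_
    obtain ⟨b, rfl⟩ := E.surjective a
    simp only [RingHom.comp_apply, RingHom.coe_coe]
    rw [E.symm_apply_apply]
    exact (mk_rename P b).trans (hB.1.algebraMap_aevalEquiv b).symm

open Classical in
/-- Polynomials in `x_1, …, x_n` as polynomials in the variables outside `B` over the polynomial
ring in the variables in `B`. -/
noncomputable def splitVars (k : Type*) [Field k] (B : Set (Fin n)) :
    MvPolynomial {j // j ∉ B} (MvPolynomial B k) ≃ₐ[k] MvPolynomial (Fin n) k :=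
  (MvPolynomial.sumAlgEquiv k {j // j ∉ B} B).symm.trans
    (MvPolynomial.renameEquiv k ((Equiv.sumComm _ _).trans (Equiv.sumCompl (· ∈ B))))

theorem splitVars_X {B : Set (Fin n)} (j : {j // j ∉ B}) :
    splitVars k B (MvPolynomial.X j) = MvPolynomial.X (j : Fin n) := by
  rw [splitVars, AlgEquiv.trans_apply, MvPolynomial.sumAlgEquiv_symm_X]
  simp

theorem splitVars_C {B : Set (Fin n)} (a : MvPolynomial B k) :
    splitVars k B (MvPolynomial.C a) = MvPolynomial.rename (↑) a := by
  induction a using MvPolynomial.induction_on with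
  | C r =>
    rw [splitVars, AlgEquiv.trans_apply, MvPolynomial.sumAlgEquiv_symm_C_C]
    simp
  | add p q hp hq => rw [map_add, map_add, hp, hq, map_add]
  | mul_X p i hp =>
    rw [map_mul, map_mul, hp, map_mul]
    congr 1
    rw [splitVars, AlgEquiv.trans_apply, MvPolynomial.sumAlgEquiv_symm_C_X]
    simp

/-- The length of a regular sequence with associated prime `P` is at least the codimension
`n - trdeg` of `P`. -/
theorem le_length_add_trdeg {fs : List (MvPolynomial (Fin n) k)} (hreg : RegSeqMod ⊥ fs)
    {P : Ideal (MvPolynomial (Fin n) k)} [P.IsPrime] {w : MvPolynomial (Fin n) k}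
    (hw : ∀ c, c ∈ P ↔ c * w ∈ Ideal.ofList fs) {d : ℕ}
    (hd : Algebra.trdeg k (MvPolynomial (Fin n) k ⧸ P) ≤ d) : n ≤ fs.length + d := by
  classical
  obtain ⟨B, hB⟩ := exists_isTranscendenceBasis_vars P
  have hcard : Nat.card B ≤ d := by
    have h1 := hB.lift_cardinalMk_eq_trdeg
    have h2 : Cardinal.lift.{0} (Algebra.trdeg k (MvPolynomial (Fin n) k ⧸ P)) ≤ (d : Cardinal) := by
      rwa [Cardinal.lift_uzero]
    rw [← h1, ← Nat.cast_card, Cardinal.lift_natCast, Nat.cast_le] at h2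
    exact h2
  let A := MvPolynomial B k
  let K := FractionRing A
  let R' := MvPolynomial {j // j ∉ B} K
  let : Algebra (MvPolynomial {j // j ∉ B} A) R' := MvPolynomial.algebraMvPolynomial
  let e := (splitVars k B).toRingEquiv
  let M : Submonoid (MvPolynomial {j // j ∉ B} A) := (nonZeroDivisors A).map MvPolynomial.C
  let : Algebra (MvPolynomial (Fin n) k) R' :=
    ((algebraMap (MvPolynomial {j // j ∉ B} A) R').comp e.symm.toRingHom).toAlgebra
  have : IsLocalization (M.map e) R' := IsLocalization.isLocalization_of_base_ringEquiv M R' e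
  have halg : ∀ y, algebraMap (MvPolynomial (Fin n) k) R' (splitVars k B y) =
      MvPolynomial.map (algebraMap A K) y := by
    intro y
    have h1 : algebraMap (MvPolynomial (Fin n) k) R' (splitVars k B y) =
      algebraMap (MvPolynomial {j // j ∉ B} A) R' (e.symm (e y)) := rfl
    rw [h1, e.symm_apply_apply, MvPolynomial.algebraMap_def]
  have hdepth : DepthGE (P.map (algebraMap (MvPolynomial (Fin n) k) R')) ⊥ (Nat.card {j // j ∉ B}) := by
    refine depthGE_mvPolynomial K {j // j ∉ B} _ fun j => ?_
    obtain ⟨p, hp, hpP⟩ := exists_eval₂_mem_of_isTranscendenceBasis P hB j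
    have hp' : p.map (algebraMap A K) ≠ 0 := by
      rwa [Ne, Polynomial.map_eq_zero_iff (IsFractionRing.injective A K)]
    refine ⟨_, Polynomial.monic_mul_leadingCoeff_inv hp', ?_⟩
    rw [map_mul]
    refine Ideal.mul_mem_right _ _ ?_
    convert! Ideal.mem_map_of_mem (algebraMap (MvPolynomial (Fin n) k) R') hpP using 1
    rw [Polynomial.hom_eval₂, Polynomial.aeval_def, Polynomial.eval₂_map, ← splitVars_X, halg,
      MvPolynomial.map_X]
    congr 1
    refine RingHom.ext fun a => ?_
    have h1 := halg (MvPolynomial.C a)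
    rw [splitVars_C, MvPolynomial.map_C] at h1
    exact h1.symm
  have hle := le_length_of_associatedPrime (R' := R') (M.map e) hreg (P := P) (by
    rintro _ ⟨_, ⟨a, ha, rfl⟩, rfl⟩ hmem
    have h0 : a = 0 := by
      apply (algebraicIndependent_iff.mp hB.1) a
      rw [← Ideal.Quotient.eq_zero_iff_mem] at hmem
      have h1 : e (MvPolynomial.C a) = MvPolynomial.rename (↑) a := splitVars_C a
      have h2 : Ideal.Quotient.mk P (e (MvPolynomial.C a)) = 0 := hmem
      rw [h1, mk_rename] at h2
      exact h2
    exact nonZeroDivisors.ne_zero ha h0) hw hdepth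
  have hsum : Nat.card B + Nat.card {j // j ∉ B} = n := by
    rw [← Nat.card_sum, Nat.card_congr (Equiv.sumCompl (· ∈ B)), Nat.card_fin]
  omega

/-- A sequence in a polynomial ring over a field is weakly regular if, for every `i`, all primes
that contain its first `i` terms have codimension at least `i`. -/
theorem isWeaklyRegular_of_trdeg_le (fs : List (MvPolynomial (Fin n) k))
    (h : ∀ i < fs.length, ∀ P : Ideal (MvPolynomial (Fin n) k), P.IsPrime →
      (∀ f ∈ fs.take (i + 1), f ∈ P) →
      ∃ d : ℕ, d + i < n ∧ Algebra.trdeg k (MvPolynomial (Fin n) k ⧸ P) ≤ d) :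
    RingTheory.Sequence.IsWeaklyRegular (MvPolynomial (Fin n) k) fs := by
  have step : ∀ i (hi : i < fs.length), RegSeqMod ⊥ (fs.take i) →
      RegMod (Ideal.ofList (fs.take i)) fs[i] := by
    intro i hi hreg
    by_contra hcon
    obtain ⟨P, hP, hfP⟩ := exists_associatedPrime_of_not_regMod hcon
    obtain ⟨hprime, w, hw⟩ := mem_associatedPrimes_quotient_iff.mp hP
    obtain ⟨d, hd, htr⟩ := h i hi P hprime (by
      intro f hf
      rw [List.take_add_one, List.mem_append] at hf
      rcases hf with hf | hf
      · exact (hw f).mpr (Ideal.mul_mem_right _ _ (Ideal.subset_span hf))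
      · simp [hi] at hf
        rwa [hf])
    have := le_length_add_trdeg hreg hw htr
    rw [List.length_take] at this
    omega
  have hall : ∀ i ≤ fs.length, RegSeqMod ⊥ (fs.take i) := by
    intro i
    induction i with
    | zero => exact fun _ => trivial
    | succ i ih =>
      intro hi
      have hi' := ih (by omega)
      rw [List.take_add_one, List.getElem?_eq_getElem (by omega)]
      exact hi'.concat (by simpa using step i (by omega) hi')
  refine ⟨fun i hi => ?_⟩
  have := step i hi (hall i hi.le)
  rw [isSMulRegular_quotient_iff_mem_of_smul_mem]
  simpa [RegMod] using this

end Criterion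

/-! ### The Wu formula for generating series -/

section Generating

variable {A : Type*} [CommRing A]

/-- The polynomial `∑ⱼ binom(r - j, j) tʲ`. -/
noncomputable def fibPoly (A : Type*) [CommRing A] (r : ℕ) : A[X] :=
  ∑ j ∈ Finset.range (r + 1), monomial j (((r - j).choose j : ℕ) : A)

theorem coeff_fibPoly (r j : ℕ) : (fibPoly A r).coeff j = ((r - j).choose j : ℕ) := by
  simp only [fibPoly, finsetSum_coeff, coeff_monomial, Finset.sum_ite_eq', Finset.mem_range]
  split_ifs with h
  · rfl
  · rw [Nat.choose_eq_zero_of_lt (by omega), Nat.cast_zero]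

theorem fibPoly_add_two (r : ℕ) :
    fibPoly A (r + 2) = fibPoly A (r + 1) + X * fibPoly A r := by
  ext j
  rw [coeff_add]
  cases j with
  | zero => simp [coeff_fibPoly]
  | succ j =>
    rw [coeff_X_mul, coeff_fibPoly, coeff_fibPoly, coeff_fibPoly]
    rcases le_or_gt j r with h | h
    · have h1 : r + 2 - (j + 1) = (r - j) + 1 := by omega
      have h2 : r + 1 - (j + 1) = r - j := by omega
      rw [h1, h2, Nat.choose_succ_succ]
      push_cast
      ring
    · rw [Nat.choose_eq_zero_of_lt (by omega), Nat.choose_eq_zero_of_lt (by omega),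
        Nat.choose_eq_zero_of_lt (by omega)]
      simp

/-- The quadratic extension `A[t][α]` with `α² = α + t`; the conjugate of `α` is `1 + α` if `2 = 0`
in `A`. -/
abbrev Split (A : Type*) [CommRing A] : Type _ := QuadraticAlgebra A[X] X 1

/-- The inclusion of `A[t]`. -/
noncomputable def splitMap (A : Type*) [CommRing A] : A[X] →+* Split A := algebraMap _ _

/-- The root `α` of `α² = α + t`. -/
noncomputable def rtA (A : Type*) [CommRing A] : Split A := ⟨0, 1⟩

/-- The conjugate root `1 + α`. -/
noncomputable def rtB (A : Type*) [CommRing A] : Split A := ⟨1, 1⟩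

theorem splitMap_injective : Function.Injective (splitMap A) := by
  intro x y h
  have := congrArg QuadraticAlgebra.re h
  simpa [splitMap] using this

instance [CharP A 2] : CharP (Split A) 2 :=
  charP_of_injective_ringHom (splitMap_injective (A := A)) 2

theorem rtA_mul_rtB [CharP A 2] : rtA A * rtB A = splitMap A X := by
  ext1
  · simp [rtA, rtB, splitMap]
  · simp [rtA, rtB, splitMap, CharTwo.add_self_eq_zero]

theorem rtA_add_rtB [CharP A 2] : rtA A + rtB A = 1 := by
  ext1
  · simp [rtA, rtB, QuadraticAlgebra.re_one]
  · simp [rtA, rtB, CharTwo.add_self_eq_zero, QuadraticAlgebra.im_one]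

/-- The power sums of the roots satisfy the recurrence `fibPoly_add_two`. -/
theorem pow_rtA_add_pow_rtB [CharP A 2] (r : ℕ) :
    rtA A ^ (r + 1) + rtB A ^ (r + 1) = splitMap A (fibPoly A r) := by
  induction r using Nat.twoStepInduction with
  | zero =>
    have : fibPoly A 0 = 1 := by simp [fibPoly]
    simp [this, rtA_add_rtB]
  | one =>
    have : fibPoly A 1 = 1 := by simp [fibPoly, Finset.sum_range_succ]
    rw [this, map_one]
    have h1 := rtA_add_rtB (A := A)
    have h2 : (2 : Split A) = 0 := CharTwo.two_eq_zero
    linear_combination (rtA A + rtB A + 1) * h1 - (rtA A * rtB A) * h2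
  | more r h0 h1 =>
    rw [fibPoly_add_two, map_add, map_mul, ← h0, ← h1, ← rtA_mul_rtB]
    have h := rtA_add_rtB (A := A)
    have h2 : (2 : Split A) = 0 := CharTwo.two_eq_zero
    linear_combination (rtA A ^ (r + 2) + rtB A ^ (r + 2)) * h
      - (rtA A * rtB A * (rtA A ^ (r + 1) + rtB A ^ (r + 1))) * h2

/-- The form `∑_p f_p g_{N-p} t^p h_{N-2p}`, `h_r = fibPoly r`, summed over `2p ≤ N`. -/
noncomputable def wuForm (f g : ℕ → A) (N : ℕ) : A[X] :=
  ∑ p ∈ Finset.range (N + 1),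
    if 2 * p ≤ N then C (f p * g (N - p)) * (X ^ p * fibPoly A (N - 2 * p)) else 0

theorem coeff_wuForm (f g : ℕ → A) (N i : ℕ) :
    (wuForm f g N).coeff i = if 2 * i ≤ N then
      ∑ j ∈ Finset.range (i + 1), (((N - 2 * i + j).choose j : ℕ) : A) * (f (i - j) * g (N - i + j))
      else 0 := by
  have hterm : ∀ p, (if 2 * p ≤ N then C (f p * g (N - p)) * (X ^ p * fibPoly A (N - 2 * p))
      else 0 : A[X]).coeff i = if 2 * p ≤ N ∧ p ≤ i then
        (((N - 2 * p - (i - p)).choose (i - p) : ℕ) : A) * (f p * g (N - p)) else 0 := by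
    intro p
    by_cases h : 2 * p ≤ N
    · by_cases hp : p ≤ i
      · rw [if_pos h, if_pos ⟨h, hp⟩, coeff_C_mul, coeff_X_pow_mul', if_pos hp, coeff_fibPoly,
          mul_comm]
      · rw [if_pos h, if_neg (by tauto), coeff_C_mul, coeff_X_pow_mul', if_neg hp, mul_zero]
    · simp [h]
  rw [wuForm, finsetSum_coeff, Finset.sum_congr rfl fun p _ => hterm p]
  split_ifs with hi
  · have hsub : Finset.range (i + 1) ⊆ Finset.range (N + 1) := by
      intro p; simp only [Finset.mem_range]; omega
    rw [← Finset.sum_subset hsub, ← Finset.sum_range_reflect]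
    · refine Finset.sum_congr rfl fun j hj => ?_
      rw [Finset.mem_range] at hj
      have h0 : i + 1 - 1 - j = i - j := by omega
      rw [h0, if_pos (by omega)]
      have h1 : N - 2 * (i - j) - (i - (i - j)) = N - 2 * i + j := by omega
      have h2 : i - (i - j) = j := by omega
      have h3 : N - (i - j) = N - i + j := by omega
      rw [h1, h2, h3]
    · intro p _ hp
      rw [Finset.mem_range] at hp
      rw [if_neg (by omega)]
  · refine Finset.sum_eq_zero fun p _ => ?_
    split_ifs with h
    · rw [Nat.choose_eq_zero_of_lt (by omega)]
      simp
    · rfl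

theorem sum_antidiagonal_split {E : Type*} [AddCommMonoid E] (G : ℕ → ℕ → E) (N : ℕ) :
    ∑ x ∈ Finset.HasAntidiagonal.antidiagonal N, G x.1 x.2 = ∑ p ∈ Finset.range (N + 1),
      ((if 2 * p ≤ N then G p (N - p) else 0) + if 2 * p < N then G (N - p) p else 0) := by
  rw [Finset.Nat.sum_antidiagonal_eq_sum_range_succ_mk, Finset.sum_add_distrib]
  have h2 : ∑ p ∈ Finset.range (N + 1), (if 2 * p < N then G (N - p) p else 0) =
      ∑ p ∈ Finset.range (N + 1), (if N < 2 * p then G p (N - p) else 0) := by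
    rw [← Finset.sum_range_reflect]
    refine Finset.sum_congr rfl fun p hp => ?_
    rw [Finset.mem_range] at hp
    have h1 : N - (N + 1 - 1 - p) = p := by omega
    have h2 : N + 1 - 1 - p = N - p := by omega
    rw [h1, h2]
    have h3 : 2 * (N - p) < N ↔ N < 2 * p := by omega
    simp only [h3]
  rw [h2, ← Finset.sum_add_distrib]
  refine Finset.sum_congr rfl fun p _ => ?_
  by_cases h : 2 * p ≤ N
  · simp [h, not_lt.mpr h]
  · simp [h, not_le.mp h]

/-- Coefficientwise extraction of the coefficient of `tⁱ`. -/
noncomputable def tCoeff (i : ℕ) (F : PowerSeries A[X]) : PowerSeries A :=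
  PowerSeries.mk fun N => (PowerSeries.coeff N F).coeff i

theorem tCoeff_mul (i : ℕ) (F G : PowerSeries A[X]) :
    tCoeff i (F * G) = ∑ x ∈ Finset.HasAntidiagonal.antidiagonal i, tCoeff x.1 F * tCoeff x.2 G := by
  ext N
  simp only [tCoeff, PowerSeries.coeff_mk, PowerSeries.coeff_mul, finsetSum_coeff, map_sum,
    Polynomial.coeff_mul]
  exact Finset.sum_comm

theorem tCoeff_ext {F G : PowerSeries A[X]} (h : ∀ i, tCoeff i F = tCoeff i G) : F = G := by
  ext N i
  simpa [tCoeff] using congrArg (PowerSeries.coeff N) (h i)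

/-- For a total operation `P x = ∑ᵢ Pᵢ(x) tⁱ`, the series `∑ₘ ∑ᵢ Pᵢ(gₘ) tⁱ ζ^{m+i}`. -/
noncomputable def totalSeries (P : A →+* A[X]) (g : PowerSeries A) : PowerSeries A[X] :=
  PowerSeries.mk fun N => ∑ i ∈ Finset.range (N + 1),
    monomial i ((P (PowerSeries.coeff (N - i) g)).coeff i)

theorem coeff_coeff_totalSeries (P : A →+* A[X]) (g : PowerSeries A) (N i : ℕ) :
    (PowerSeries.coeff N (totalSeries P g)).coeff i =
      if i ≤ N then (P (PowerSeries.coeff (N - i) g)).coeff i else 0 := by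
  simp only [totalSeries, PowerSeries.coeff_mk, finsetSum_coeff, coeff_monomial,
    Finset.sum_ite_eq', Finset.mem_range, Nat.lt_succ_iff]

theorem tCoeff_totalSeries (P : A →+* A[X]) (g : PowerSeries A) (i : ℕ) :
    tCoeff i (totalSeries P g) = PowerSeries.X ^ i * tCoeff i (PowerSeries.map P g) := by
  ext N
  rw [PowerSeries.coeff_X_pow_mul']
  simp only [tCoeff, PowerSeries.coeff_mk, PowerSeries.coeff_map]
  rw [coeff_coeff_totalSeries]

theorem totalSeries_mul (P : A →+* A[X]) (f g : PowerSeries A) :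
    totalSeries P (f * g) = totalSeries P f * totalSeries P g := by
  refine tCoeff_ext fun i => ?_
  simp only [tCoeff_totalSeries, tCoeff_mul, map_mul, Finset.mul_sum]
  refine Finset.sum_congr rfl fun x hx => ?_
  rw [← Finset.HasAntidiagonal.mem_antidiagonal.mp hx, pow_add]
  ring

variable [CharP A 2]

/-- The coefficients of `c(αζ) c(βζ)`: the terms `(p, q)` and `(q, p)` of the product combine to
`t^p (α^{q-p} + β^{q-p})`, which `pow_rtA_add_pow_rtB` expresses by binomial coefficients. -/
theorem coeff_rescale_mul_rescale (c : ℕ → A) (N : ℕ) :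
    ∑ x ∈ Finset.HasAntidiagonal.antidiagonal N,
      (rtA A ^ x.1 * splitMap A (C (c x.1))) * (rtB A ^ x.2 * splitMap A (C (c x.2))) =
    splitMap A ((if N = 0 then 0 else wuForm c (fun q => c (q + 1)) (N - 1)) +
      if Even N then C (c (N / 2) ^ 2) * X ^ (N / 2) else 0) := by
  rw [sum_antidiagonal_split (fun p q =>
    (rtA A ^ p * splitMap A (C (c p))) * (rtB A ^ q * splitMap A (C (c q)))) N]
  cases N with
  | zero => simp [pow_two]
  | succ N =>
    have hterm : ∀ p, ((if 2 * p ≤ N + 1 then rtA A ^ p * splitMap A (C (c p)) *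
          (rtB A ^ (N + 1 - p) * splitMap A (C (c (N + 1 - p)))) else 0) +
        if 2 * p < N + 1 then rtA A ^ (N + 1 - p) * splitMap A (C (c (N + 1 - p))) *
          (rtB A ^ p * splitMap A (C (c p))) else 0) =
        splitMap A ((if 2 * p ≤ N then
          C (c p * c (N - p + 1)) * (X ^ p * fibPoly A (N - 2 * p)) else 0) +
          if 2 * p = N + 1 then C (c p ^ 2) * X ^ p else 0) := by
      intro p
      rcases lt_trichotomy (2 * p) (N + 1) with h | h | h
      · obtain ⟨r, rfl⟩ : ∃ r, N = 2 * p + r := ⟨N - 2 * p, by omega⟩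
        have h1 : 2 * p + r + 1 - p = p + (r + 1) := by omega
        have h2 : 2 * p + r - p + 1 = p + (r + 1) := by omega
        rw [if_pos h.le, if_pos h, if_pos (by omega), if_neg (by omega), h1, h2, add_zero,
          Nat.add_sub_cancel_left, map_mul, map_mul (splitMap A) (X ^ p), map_pow, ← rtA_mul_rtB,
          ← pow_rtA_add_pow_rtB, C_mul, map_mul]
        ring
      · have h1 : N + 1 - p = p := by omega
        rw [if_pos h.le, if_neg (by omega), if_neg (by omega), if_pos h, h1, add_zero, zero_add,
          C_pow, map_mul, map_pow, map_pow, ← rtA_mul_rtB]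
        ring
      · rw [if_neg (by omega), if_neg (by omega), if_neg (by omega), if_neg (by omega)]
        simp
    have hdiag : ∑ p ∈ Finset.range (N + 2), (if 2 * p = N + 1 then C (c p ^ 2) * X ^ p
        else 0 : A[X]) = if Even (N + 1) then C (c ((N + 1) / 2) ^ 2) * X ^ ((N + 1) / 2)
        else 0 := by
      split_ifs with he
      · have h1 := Nat.two_mul_div_two_of_even he
        rw [Finset.sum_eq_single ((N + 1) / 2)]
        · rw [if_pos h1]
        · intro p _ hp
          rw [if_neg (by omega)]
        · intro h
          rw [Finset.mem_range] at h
          omega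
      · refine Finset.sum_eq_zero fun p _ => if_neg fun h => he ⟨p, by omega⟩
    rw [Finset.sum_congr rfl fun p _ => hterm p, ← map_sum, Finset.sum_add_distrib, hdiag,
      if_neg (Nat.succ_ne_zero N), Finset.sum_range_succ, if_neg (by omega), add_zero, wuForm]
    rfl

/-- The coefficients of `α d(αζ) c(βζ) + β d(βζ) c(αζ)`. -/
theorem coeff_rescale_mul_rescale' (c d : ℕ → A) (N : ℕ) :
    ∑ x ∈ Finset.HasAntidiagonal.antidiagonal N,
      splitMap A (C (c x.1)) * splitMap A (C (d x.2)) *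
        (rtA A ^ (x.2 + 1) * rtB A ^ x.1 + rtB A ^ (x.2 + 1) * rtA A ^ x.1) =
    splitMap A (wuForm c d N +
      if 2 ≤ N then X * wuForm d (fun q => c (q + 2)) (N - 2) else 0) := by
  rw [sum_antidiagonal_split (fun p q => splitMap A (C (c p)) * splitMap A (C (d q)) *
        (rtA A ^ (q + 1) * rtB A ^ p + rtB A ^ (q + 1) * rtA A ^ p)) N,
    Finset.sum_add_distrib, map_add]
  congr 1
  · rw [wuForm, map_sum]
    refine Finset.sum_congr rfl fun p _ => ?_
    split_ifs with h
    · obtain ⟨r, rfl⟩ : ∃ r, N = 2 * p + r := ⟨N - 2 * p, by omega⟩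
      have h1 : 2 * p + r - p = p + r := by omega
      rw [h1, Nat.add_sub_cancel_left, map_mul, map_mul (splitMap A) (X ^ p), map_pow,
        ← rtA_mul_rtB, ← pow_rtA_add_pow_rtB, C_mul, map_mul]
      ring
    · simp
  · have hodd : ∀ p, 2 * p + 1 = N → splitMap A (C (c (N - p))) * splitMap A (C (d p)) *
        (rtA A ^ (p + 1) * rtB A ^ (N - p) + rtB A ^ (p + 1) * rtA A ^ (N - p)) = 0 := by
      intro p hp
      have h1 : N - p = p + 1 := by omega
      rw [h1, mul_comm (rtB A ^ (p + 1)), CharTwo.add_self_eq_zero, mul_zero]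
    rcases lt_or_ge N 2 with hN | hN
    · rw [if_neg (by omega), map_zero]
      refine Finset.sum_eq_zero fun p _ => ?_
      split_ifs with h
      · exact hodd p (by omega)
      · rfl
    · obtain ⟨N, rfl⟩ : ∃ M, N = M + 2 := ⟨N - 2, by omega⟩
      rw [if_pos (by omega), Finset.sum_range_succ, Finset.sum_range_succ, if_neg (by omega),
        if_neg (by omega), add_zero, add_zero, wuForm, map_mul, map_sum, Finset.mul_sum]
      refine Finset.sum_congr rfl fun p _ => ?_
      rcases lt_trichotomy (2 * p + 1) (N + 2) with h | h | h
      · obtain ⟨r, rfl⟩ : ∃ r, N = 2 * p + r := ⟨N - 2 * p, by omega⟩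
        have h1 : 2 * p + r + 2 - p = p + 1 + (r + 1) := by omega
        have h2 : 2 * p + r + 2 - 2 - p + 2 = p + 1 + (r + 1) := by omega
        have h3 : 2 * p + r + 2 - 2 - 2 * p = r := by omega
        rw [if_pos (by omega), if_pos (by omega), h1, h2, h3, map_mul, map_mul (splitMap A) (X ^ p),
          map_pow, ← rtA_mul_rtB, ← pow_rtA_add_pow_rtB, C_mul, map_mul]
        ring
      · rw [if_pos (by omega), if_neg (by omega), hodd p h]
        simp
      · rw [if_neg (by omega), if_neg (by omega)]
        simp

/-- If the operation `P` satisfies the Wu formula on `c` and `d = c p`, then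
`Pᵢ(p_k) = binom(k, i) p_{k+i}`. -/
theorem coeff_map_quotient (P : A →+* A[X]) (c d p : PowerSeries A) (hcp : d = c * p)
    (hc0 : PowerSeries.constantCoeff c = 1)
    (hc : ∀ m i, (P (PowerSeries.coeff m c)).coeff i = if i < m then
      ∑ j ∈ Finset.range (i + 1), (((m - i + j - 1).choose j : ℕ) : A) *
        (PowerSeries.coeff (i - j) c * PowerSeries.coeff (m + j) c)
      else if i = m then PowerSeries.coeff m c ^ 2 else 0)
    (hd : ∀ m i, (P (PowerSeries.coeff m d)).coeff i = if i ≤ m then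
      ∑ j ∈ Finset.range (i + 1), (((m - i + j).choose j : ℕ) : A) *
        (PowerSeries.coeff (i - j) c * PowerSeries.coeff (m + j) d) +
      ∑ j ∈ Finset.range i, (((m - i + j).choose j : ℕ) : A) *
        (PowerSeries.coeff (i - 1 - j) d * PowerSeries.coeff (m + j + 1) c)
      else 0) (k i : ℕ) :
    (P (PowerSeries.coeff k p)).coeff i = (k.choose i : ℕ) * PowerSeries.coeff (k + i) p := by
  let φ := splitMap A
  let ι : A →+* Split A := φ.comp C
  let a := PowerSeries.rescale (rtA A)
  let b := PowerSeries.rescale (rtB A)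
  let c' := PowerSeries.map ι c
  let d' := PowerSeries.map ι d
  let p' := PowerSeries.map ι p
  -- the Wu formula for `c`
  have hC : PowerSeries.map φ (totalSeries P c) = a c' * b c' := by
    ext1 N
    rw [PowerSeries.coeff_map, PowerSeries.coeff_mul]
    simp only [a, b, c', PowerSeries.coeff_rescale, PowerSeries.coeff_map, ι, φ,
      RingHom.comp_apply]
    rw [coeff_rescale_mul_rescale (fun m => PowerSeries.coeff m c) N]
    congr 1
    ext i
    rw [coeff_coeff_totalSeries, hc, coeff_add]
    rcases lt_trichotomy (2 * i) N with h | h | h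
    · rw [if_pos (by omega), if_pos (by omega), if_neg (by omega), coeff_wuForm, if_pos (by omega)]
      have h2 : (if Even N then C (PowerSeries.coeff (N / 2) c ^ 2) * X ^ (N / 2) else 0 :
          A[X]).coeff i = 0 := by
        split_ifs with he
        · obtain ⟨q, rfl⟩ := he
          rw [coeff_C_mul_X_pow, if_neg (by omega)]
        · rfl
      rw [h2, add_zero]
      refine Finset.sum_congr rfl fun j _ => ?_
      have h3 : N - i - i + j - 1 = N - 1 - 2 * i + j := by omega
      have h4 : N - i + j = N - 1 - i + j + 1 := by omega
      rw [h3, h4]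
    · subst h
      have h2 : 2 * i - i = i := by omega
      rw [if_pos (by omega), h2, if_neg (lt_irrefl i), if_pos rfl, if_pos (even_two_mul i),
        Nat.mul_div_cancel_left i two_pos, coeff_C_mul_X_pow, if_pos rfl]
      split_ifs
      · simp
      · rw [coeff_wuForm, if_neg (by omega), zero_add]
    · have h1 : (if i ≤ N then if i < N - i then ∑ j ∈ Finset.range (i + 1),
          (((N - i - i + j - 1).choose j : ℕ) : A) *
            (PowerSeries.coeff (i - j) c * PowerSeries.coeff (N - i + j) c)
          else if i = N - i then PowerSeries.coeff (N - i) c ^ 2 else 0 else 0) = 0 := by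
        split_ifs <;> first | rfl | omega
      have h2 : (if Even N then C (PowerSeries.coeff (N / 2) c ^ 2) * X ^ (N / 2) else 0 :
          A[X]).coeff i = 0 := by
        split_ifs with he
        · obtain ⟨q, rfl⟩ := he
          rw [coeff_C_mul_X_pow, if_neg (by omega)]
        · rfl
      rw [h1, h2]
      split_ifs
      · simp
      · rw [coeff_wuForm, if_neg (by omega), zero_add]
  -- the Wu formula for `d`
  have hD : PowerSeries.map φ (totalSeries P d) =
      PowerSeries.C (rtA A) * a d' * b c' + PowerSeries.C (rtB A) * b d' * a c' := by
    ext1 N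
    have h1 : PowerSeries.coeff N
        (PowerSeries.C (rtA A) * a d' * b c' + PowerSeries.C (rtB A) * b d' * a c') =
        ∑ x ∈ Finset.HasAntidiagonal.antidiagonal N,
          splitMap A (C (PowerSeries.coeff x.1 c)) * splitMap A (C (PowerSeries.coeff x.2 d)) *
          (rtA A ^ (x.2 + 1) * rtB A ^ x.1 + rtB A ^ (x.2 + 1) * rtA A ^ x.1) := by
      rw [mul_assoc, mul_assoc, map_add, PowerSeries.coeff_C_mul, PowerSeries.coeff_C_mul,
        mul_comm (a d'), mul_comm (b d'), PowerSeries.coeff_mul, PowerSeries.coeff_mul,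
        Finset.mul_sum, Finset.mul_sum, ← Finset.sum_add_distrib]
      refine Finset.sum_congr rfl fun x _ => ?_
      simp only [a, b, c', d', PowerSeries.coeff_rescale, PowerSeries.coeff_map, ι, φ,
        RingHom.comp_apply]
      ring
    rw [h1, coeff_rescale_mul_rescale' (fun m => PowerSeries.coeff m c)
      (fun m => PowerSeries.coeff m d) N, PowerSeries.coeff_map]
    congr 1
    ext i
    rw [coeff_coeff_totalSeries, hd, coeff_add, coeff_wuForm]
    by_cases h : 2 * i ≤ N
    · rw [if_pos (by omega), if_pos (by omega), if_pos h]
      congr 1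
      · refine Finset.sum_congr rfl fun j _ => ?_
        have h3 : N - i - i + j = N - 2 * i + j := by omega
        rw [h3]
      · cases i with
        | zero => split_ifs <;> simp
        | succ i =>
          rw [if_pos (by omega), coeff_X_mul, coeff_wuForm, if_pos (by omega)]
          refine Finset.sum_congr rfl fun j _ => ?_
          have h3 : N - (i + 1) - (i + 1) + j = N - 2 - 2 * i + j := by omega
          have h4 : N - (i + 1) + j + 1 = N - 2 - i + j + 2 := by omega
          rw [h3, h4, Nat.add_sub_cancel]
    · have h2 : ¬ i ≤ N - i := by omega
      rw [if_neg h2, if_neg h, ite_self, zero_add]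
      split_ifs
      · cases i with
        | zero => omega
        | succ i => rw [coeff_X_mul, coeff_wuForm, if_neg (by omega)]
      · rfl
  -- division of the formula for `d` by that for `c`
  have hP : PowerSeries.map φ (totalSeries P p) =
      PowerSeries.C (rtA A) * a p' + PowerSeries.C (rtB A) * b p' := by
    have hunit : IsUnit (PowerSeries.map φ (totalSeries P c)) := by
      have h1 : ∀ x : Split A, PowerSeries.constantCoeff (PowerSeries.rescale x c') = 1 := by
        intro x
        rw [← PowerSeries.coeff_zero_eq_constantCoeff_apply, PowerSeries.coeff_rescale,
          PowerSeries.coeff_map, PowerSeries.coeff_zero_eq_constantCoeff_apply, hc0]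
        simp
      rw [hC, PowerSeries.isUnit_iff_constantCoeff, map_mul, h1, h1, one_mul]
      exact isUnit_one
    refine hunit.mul_left_cancel ?_
    rw [← map_mul, ← totalSeries_mul, ← hcp, hD, hC]
    have : d' = c' * p' := by simp [d', c', p', hcp]
    rw [this, map_mul, map_mul]
    ring
  have hN : PowerSeries.coeff (k + i) (totalSeries P p) =
      C (PowerSeries.coeff (k + i) p) * fibPoly A (k + i) := by
    apply splitMap_injective
    have := congrArg (PowerSeries.coeff (k + i)) hP
    rw [PowerSeries.coeff_map] at this
    rw [this, map_mul, ← pow_rtA_add_pow_rtB]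
    simp only [a, b, p', map_add, PowerSeries.coeff_C_mul, PowerSeries.coeff_rescale,
      PowerSeries.coeff_map, ι, φ, RingHom.comp_apply]
    ring
  have := congrArg (fun q => q.coeff i) hN
  simp only [coeff_coeff_totalSeries, coeff_C_mul, coeff_fibPoly] at this
  simpa [mul_comm] using this

end Generating

/-! ### The Steenrod operations modulo `τ` and the classes `θ_j` -/

section Reduction

/-- The class `u_i` in `S_n`. -/
noncomputable def su (n i : ℕ) : S n :=
  if i = 0 then 1 else if h : i - 1 < n then MvPolynomial.X ⟨i - 1, h⟩ else 0

theorem su_succ {n : ℕ} (i : Fin n) : su n (i + 1) = MvPolynomial.X i := by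
  simp [su]

theorem su_eq_zero {n i : ℕ} (h : n < i) : su n i = 0 := by
  rw [su, if_neg (by omega), dif_neg (by omega)]

variable (k : Type*) [Field k] (n : ℕ)

theorem gamma_u (i : ℕ) : gamma k n (u k n i) = su n i := by
  unfold u su gamma
  split_ifs <;> simp

/-- The operations `Sq^{2i}` modulo `τ` and the symbols, as a ring homomorphism
`x ↦ ∑ᵢ Sq^{2i}(x) tⁱ`; multiplicative since the Cartan formula has no odd terms modulo `τ`. -/
noncomputable def evenTotal : S n →+* (S n)[X] :=
  MvPolynomial.eval₂Hom (Polynomial.C.comp MvPolynomial.C)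
    (fun i => (total k n (MvPolynomial.X i)).re.map (gamma k n))

theorem evenTotal_gamma (x : HBO k n) :
    evenTotal k n (gamma k n x) = (total k n x).re.map (gamma k n) := by
  have htau : gamma k n (MvPolynomial.C (tau k)) = 0 := by
    simp [gamma, tau, augH]
  induction x using MvPolynomial.induction_on with
  | C c =>
    rw [total_C]
    simp [gamma, evenTotal]
  | add p q hp hq => simp [hp, hq]
  | mul_X p i hp =>
    rw [map_mul, map_mul, hp, map_mul, QuadraticAlgebra.re_mul]
    simp only [Polynomial.map_add, Polynomial.map_mul, Polynomial.map_C, htau, C_0, zero_mul,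
      add_zero]
    congr 1
    simp [evenTotal, gamma]

theorem coeff_evenTotal_gamma (x : HBO k n) (i : ℕ) :
    (evenTotal k n (gamma k n x)).coeff i = gamma k n (Sq k n (2 * i) x) := by
  rw [evenTotal_gamma, coeff_map, Sq_even]

theorem gamma_wu (a m : ℕ) : gamma k n (wu k n a m) = if a < m then
    ∑ j ∈ Finset.range (a + 1), (((m + j - a - 1).choose j : ℕ) : S n) * (su n (a - j) * su n (m + j))
    else if a = m then su n m ^ 2 else 0 := by
  unfold wu
  split_ifs
  · simp only [map_sum, map_mul, gamma_u, nsmul_eq_mul, map_natCast]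
  · rw [map_pow, gamma_u]
  · exact map_zero _

theorem coeff_evenTotal_su (i m : ℕ) :
    (evenTotal k n (su n m)).coeff i = if 2 * i < m then
      ∑ j ∈ Finset.range (2 * i + 1),
        (((m + j - 2 * i - 1).choose j : ℕ) : S n) * (su n (2 * i - j) * su n (m + j))
      else if 2 * i = m then su n m ^ 2 else 0 := by
  rw [← gamma_wu k, ← gamma_u k, coeff_evenTotal_gamma]
  rcases Nat.eq_zero_or_pos m with rfl | hm
  · have h0 : u k n 0 = MvPolynomial.C 1 := by simp [u]
    rw [h0, Sq_C, wu, if_neg (Nat.not_lt_zero _)]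
    rcases Nat.eq_zero_or_pos i with rfl | hi
    · simp [h0]
    · rw [if_neg (by omega), if_neg (by omega)]
  rcases le_or_gt m n with hmn | hmn
  · rw [Sq_u k n _ _ hm hmn]
  · have h0 : u k n m = MvPolynomial.C 0 := by
      rw [u, if_neg (by omega), dif_neg (by omega), map_zero]
    rw [h0, Sq_C]
    rw [gamma_wu]
    have h1 : ∀ j, su n (m + j) = 0 := fun j => su_eq_zero (by omega)
    have h2 : su n m = 0 := su_eq_zero hmn
    simp [h1, h2]

theorem sum_range_two_mul_add_one {E : Type*} [AddCommMonoid E] (f : ℕ → E) (i : ℕ) :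
    ∑ j ∈ Finset.range (2 * i + 1), f j =
      ∑ j ∈ Finset.range (i + 1), f (2 * j) + ∑ j ∈ Finset.range i, f (2 * j + 1) := by
  induction i with
  | zero => simp
  | succ i ih =>
    rw [show 2 * (i + 1) + 1 = 2 * i + 1 + 1 + 1 by ring, Finset.sum_range_succ,
      Finset.sum_range_succ, ih, Finset.sum_range_succ (fun j => f (2 * j)) (i + 1),
      Finset.sum_range_succ (fun j => f (2 * j + 1)) i, show 2 * (i + 1) = 2 * i + 1 + 1 by ring]
    abel

section Lucas

variable {A : Type*} [CommRing A] [CharP A 2]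

theorem cast_choose_eq (a b : ℕ) :
    ((a.choose b : ℕ) : A) = (((a % 2).choose (b % 2) * (a / 2).choose (b / 2) : ℕ) : A) :=
  CharP.natCast_eq_natCast' A 2 (Choose.choose_modEq_choose_mod_mul_choose_div_nat (p := 2))

theorem cast_choose_odd_even (a b : ℕ) :
    (((2 * a + 1).choose (2 * b) : ℕ) : A) = (a.choose b : ℕ) := by
  rw [cast_choose_eq, show (2 * a + 1) % 2 = 1 by omega, show 2 * b % 2 = 0 by omega,
    show (2 * a + 1) / 2 = a by omega, show 2 * b / 2 = b by omega]
  simp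

theorem cast_choose_even_even (a b : ℕ) :
    (((2 * a).choose (2 * b) : ℕ) : A) = (a.choose b : ℕ) := by
  rw [cast_choose_eq, show (2 * a) % 2 = 0 by omega, show 2 * b % 2 = 0 by omega,
    show (2 * a) / 2 = a by omega, show 2 * b / 2 = b by omega]
  simp

theorem cast_choose_odd_odd (a b : ℕ) :
    (((2 * a + 1).choose (2 * b + 1) : ℕ) : A) = (a.choose b : ℕ) := by
  rw [cast_choose_eq, show (2 * a + 1) % 2 = 1 by omega, show (2 * b + 1) % 2 = 1 by omega,
    show (2 * a + 1) / 2 = a by omega, show (2 * b + 1) / 2 = b by omega]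
  simp

theorem cast_choose_even_odd (a b : ℕ) :
    (((2 * a).choose (2 * b + 1) : ℕ) : A) = 0 := by
  rw [cast_choose_eq, show (2 * a) % 2 = 0 by omega, show (2 * b + 1) % 2 = 1 by omega]
  simp

end Lucas

/-- The generating series of the even classes `u_{2m}`. -/
noncomputable def cSeries : PowerSeries (S n) := PowerSeries.mk fun m => su n (2 * m)

/-- The generating series of the odd classes `u_{2m+1}`. -/
noncomputable def dSeries : PowerSeries (S n) := PowerSeries.mk fun m => su n (2 * m + 1)

/-- The quotient of the generating series of the odd and of the even classes. -/
noncomputable def pSeries : PowerSeries (S n) :=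
  dSeries n * PowerSeries.invOfUnit (cSeries n) 1

theorem constantCoeff_cSeries : PowerSeries.constantCoeff (cSeries n) = 1 := by
  rw [← PowerSeries.coeff_zero_eq_constantCoeff_apply, cSeries, PowerSeries.coeff_mk]
  simp [su]

theorem cSeries_mul_pSeries : dSeries n = cSeries n * pSeries n := by
  rw [pSeries, mul_left_comm, PowerSeries.mul_invOfUnit _ _ (constantCoeff_cSeries n), mul_one]

/-- Modulo `τ` and the symbols, `Sq^{2i}(p_m) = binom(m, i) p_{m+i}`. -/
theorem coeff_evenTotal_pSeries (m i : ℕ) :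
    (evenTotal k n (PowerSeries.coeff m (pSeries n))).coeff i =
      (m.choose i : ℕ) * PowerSeries.coeff (m + i) (pSeries n) := by
  refine coeff_map_quotient (evenTotal k n) (cSeries n) (dSeries n) (pSeries n)
    (cSeries_mul_pSeries n) (constantCoeff_cSeries n) ?_ ?_ m i
  · intro m i
    simp only [cSeries, PowerSeries.coeff_mk]
    rw [coeff_evenTotal_su]
    rcases lt_trichotomy i m with h | h | h
    · rw [if_pos (by omega), if_pos h, sum_range_two_mul_add_one]
      have h0 : ∑ j ∈ Finset.range i, (((2 * m + (2 * j + 1) - 2 * i - 1).choose (2 * j + 1) : ℕ) :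
          S n) * (su n (2 * i - (2 * j + 1)) * su n (2 * m + (2 * j + 1))) = 0 := by
        refine Finset.sum_eq_zero fun j _ => ?_
        rw [show 2 * m + (2 * j + 1) - 2 * i - 1 = 2 * (m - i + j) by omega, cast_choose_even_odd,
          zero_mul]
      rw [h0, add_zero]
      refine Finset.sum_congr rfl fun j _ => ?_
      rw [show 2 * m + 2 * j - 2 * i - 1 = 2 * (m - i + j - 1) + 1 by omega, cast_choose_odd_even,
        show 2 * i - 2 * j = 2 * (i - j) by omega, show 2 * m + 2 * j = 2 * (m + j) by ring]
    · rw [if_neg (by omega), if_pos (by omega), if_neg (by omega), if_pos h]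
    · rw [if_neg (by omega), if_neg (by omega), if_neg (by omega), if_neg (by omega)]
  · intro m i
    simp only [cSeries, dSeries, PowerSeries.coeff_mk]
    rw [coeff_evenTotal_su]
    by_cases h : i ≤ m
    · rw [if_pos (by omega), if_pos h, sum_range_two_mul_add_one]
      refine congrArg₂ (· + ·) ?_ ?_
      · refine Finset.sum_congr rfl fun j _ => ?_
        rw [show 2 * m + 1 + 2 * j - 2 * i - 1 = 2 * (m - i + j) by omega, cast_choose_even_even,
          show 2 * i - 2 * j = 2 * (i - j) by omega,
          show 2 * m + 1 + 2 * j = 2 * (m + j) + 1 by ring]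
      · refine Finset.sum_congr rfl fun j hj => ?_
        rw [Finset.mem_range] at hj
        rw [show 2 * m + 1 + (2 * j + 1) - 2 * i - 1 = 2 * (m - i + j) + 1 by omega,
          cast_choose_odd_odd, show 2 * i - (2 * j + 1) = 2 * (i - 1 - j) + 1 by omega,
          show 2 * m + 1 + (2 * j + 1) = 2 * (m + j + 1) by ring]
    · rw [if_neg (by omega), if_neg (by omega), if_neg h]

theorem coeff_zero_pSeries : PowerSeries.coeff 0 (pSeries n) = su n 1 := by
  have h := congrArg (PowerSeries.coeff 0) (cSeries_mul_pSeries n)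
  simp [PowerSeries.coeff_mul, cSeries, dSeries, su] at h
  simp [h, su]

theorem coeff_one_pSeries : PowerSeries.coeff 1 (pSeries n) = su n 1 * su n 2 + su n 3 := by
  have h := congrArg (PowerSeries.coeff 1) (cSeries_mul_pSeries n)
  rw [PowerSeries.coeff_mul, Finset.Nat.sum_antidiagonal_eq_sum_range_succ_mk,
    Finset.sum_range_succ, Finset.sum_range_one, coeff_zero_pSeries] at h
  simp only [cSeries, dSeries, PowerSeries.coeff_mk] at h
  have h0 : su n (2 * 0) = 1 := by simp [su]
  have h2 : (2 : S n) = 0 := CharTwo.two_eq_zero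
  rw [h0] at h
  linear_combination -h - su n 1 * su n 2 * h2

/-- The classes `θ_j`, `j ≥ 1`, reduce to the coefficients of `w^{2^{j-1}}` in the quotient of the
generating series of the odd and of the even classes. -/
theorem gamma_theta_succ (hn : 2 ≤ n) (j : ℕ) :
    gamma k n (theta k n (j + 1)) = PowerSeries.coeff (2 ^ j) (pSeries n) := by
  induction j with
  | zero =>
    have h1 : theta k n (0 + 1) = Sq k n 1 (u k n 2) := by simp [theta]
    rw [h1, Sq_u k n 1 2 (by omega) hn, gamma_wu, pow_zero, coeff_one_pSeries]
    simp [Finset.sum_range_succ, su]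
  | succ j ih =>
    have h1 : theta k n (j + 1 + 1) = Sq k n (2 * 2 ^ j) (theta k n (j + 1)) := by
      rw [theta, pow_succ']
    rw [h1, ← coeff_evenTotal_gamma, ih, coeff_evenTotal_pSeries, Nat.choose_self, pow_succ',
      two_mul]
    simp

end Reduction

/-! ### Additive polynomials and transcendence degrees -/

section Additive

variable {L : Type*} [Field L]

/-- The polynomial `T^{2^e} + ∑_{j<e} a_j T^{2^j} + b`. -/
noncomputable def affinePoly {e : ℕ} (a : Fin e → L) (b : L) : L[X] :=
  X ^ 2 ^ e + ((∑ j, C (a j) * X ^ 2 ^ (j : ℕ)) + C b)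

theorem affinePoly_tail_degree {e : ℕ} (a : Fin e → L) (b : L) :
    ((∑ j, C (a j) * X ^ 2 ^ (j : ℕ)) + C b).degree < (2 ^ e : ℕ) := by
  rw [← mem_degreeLT]
  refine add_mem (Submodule.sum_mem _ fun j _ => ?_) ?_
  · rw [mem_degreeLT]
    refine (degree_C_mul_X_pow_le _ _).trans_lt ?_
    exact_mod_cast Nat.pow_lt_pow_right one_lt_two j.2
  · rw [mem_degreeLT]
    exact degree_C_le.trans_lt (by exact_mod_cast Nat.two_pow_pos e)

theorem affinePoly_monic {e : ℕ} (a : Fin e → L) (b : L) : (affinePoly a b).Monic :=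
  monic_X_pow_add (affinePoly_tail_degree a b)

theorem affinePoly_map {L' : Type*} [Field L'] (f : L →+* L') {e : ℕ} (a : Fin e → L) (b : L) :
    (affinePoly a b).map f = affinePoly (fun j => f (a j)) (f b) := by
  simp [affinePoly, Polynomial.map_sum]

theorem eval_affinePoly {e : ℕ} (a : Fin e → L) (b y : L) :
    (affinePoly a b).eval y = y ^ 2 ^ e + ((∑ j, a j * y ^ 2 ^ (j : ℕ)) + b) := by
  simp [affinePoly, eval_finsetSum]

/-- An additive polynomial plus a constant that vanishes on an odd number of elements with sum zero
has zero constant term. -/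
theorem affinePoly_const_eq_zero_of_odd [CharP L 2] {e : ℕ} {a : Fin e → L} {b : L} {F : L[X]}
    (hF : F.Monic) (hdvd : F ∣ affinePoly a b) (hodd : Odd F.natDegree) (htr : F.nextCoeff = 0) :
    b = 0 := by
  let Ω := AlgebraicClosure L
  let φ := algebraMap L Ω
  have : CharP Ω 2 := charP_of_injective_algebraMap φ.injective 2
  have hs : (F.map φ).Splits := IsAlgClosed.splits _
  have hsum : (F.map φ).roots.sum = 0 := by
    have h1 := hs.nextCoeff_eq_neg_sum_roots_of_monic (hF.map φ)
    rw [nextCoeff_map φ.injective, htr, map_zero] at h1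
    exact neg_eq_zero.mp h1.symm
  have hcard : Multiset.card (F.map φ).roots = F.natDegree := by
    rw [← hs.natDegree_eq_card_roots, natDegree_map]
  have hroot : ∀ y ∈ (F.map φ).roots, (affinePoly (fun j => φ (a j)) (φ b)).eval y = 0 := by
    intro y hy
    have h1 : F.map φ ∣ affinePoly (fun j => φ (a j)) (φ b) := by
      rw [← affinePoly_map]
      exact Polynomial.map_dvd φ hdvd
    exact eval_eq_zero_of_dvd_of_eval_eq_zero h1 (isRoot_of_mem_roots hy)
  -- power sums with exponent `2^i` are powers of the sum of the roots
  have hpow : ∀ i, ((F.map φ).roots.map fun y => y ^ 2 ^ i).sum = 0 := by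
    intro i
    rw [← multiset_sum_pow_char_pow, hsum, zero_pow (by positivity)]
  have htot : ((F.map φ).roots.map fun y =>
      (affinePoly (fun j => φ (a j)) (φ b)).eval y).sum = 0 := by
    rw [Multiset.map_congr rfl hroot]
    simp
  simp only [eval_affinePoly] at htot
  rw [Multiset.sum_map_add, Multiset.sum_map_add, hpow, zero_add] at htot
  have hlin : ((F.map φ).roots.map fun y => ∑ j, φ (a j) * y ^ 2 ^ (j : ℕ)).sum = 0 := by
    rw [Multiset.sum_map_sum]
    simp [Multiset.sum_map_mul_left, hpow]
  rw [hlin, zero_add, Multiset.map_const', Multiset.sum_replicate, hcard] at htot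
  obtain ⟨q, hq⟩ := hodd
  rw [hq, add_smul, mul_smul, one_smul, two_smul, CharTwo.add_self_eq_zero, zero_add] at htot
  exact φ.injective (by rw [htot, map_zero])

/-- The coefficients of a monic divisor of a monic polynomial are algebraic over the field
generated by the coefficients of the latter. -/
theorem coeff_mem_algebraicClosure_of_dvd {k κ : Type*} [Field k] [Field κ] [Algebra k κ]
    {G A : κ[X]} (hG : G.Monic) (hA : A.Monic) (hdvd : G ∣ A) (E : IntermediateField k κ)
    (hE : ∀ i, A.coeff i ∈ E) (i : ℕ) : G.coeff i ∈ algebraicClosure E κ := by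
  have hlift : A ∈ lifts (algebraMap E κ) := by
    rw [lifts_iff_coeff_lifts]
    intro n
    exact ⟨⟨_, hE n⟩, rfl⟩
  obtain ⟨A', hA', -, hmon⟩ := lifts_and_natDegree_eq_and_monic hlift hA
  have h := integralClosure.mem_lifts_of_monic_of_dvd_map κ hmon hG (by rwa [hA'])
  rw [lifts_iff_coeff_lifts] at h
  obtain ⟨y, hy⟩ := h i
  rw [mem_algebraicClosure_iff, ← hy]
  exact y.2.isAlgebraic

open scoped IntermediateField.algebraAdjoinAdjoin in
theorem trdeg_le_of_isAlgebraic_adjoin {k κ : Type*} [Field k] [Field κ] [Algebra k κ]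
    {s : Set κ} (h : algebraicClosure (IntermediateField.adjoin k s) κ = ⊤) :
    Algebra.trdeg k κ ≤ Cardinal.mk s := by
  have h1 : Algebra.IsAlgebraic (IntermediateField.adjoin k s) κ :=
    ⟨fun x => mem_algebraicClosure_iff.mp (h ▸ IntermediateField.mem_top)⟩
  have h2 : Algebra.IsAlgebraic (Algebra.adjoin k s) κ :=
    (IsFractionRing.comap_isAlgebraic_iff (K := IntermediateField.adjoin k s)).mpr h1
  exact Algebra.IsAlgebraic.trdeg_le_cardinalMk k s

end Additive

section Recurrence

variable {L κ : Type*} [Field L] [Field κ] [Algebra L κ]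

/-- The polynomial `T^M + c_1 T^{M-1} + ⋯ + c_m T^{M-m}`. -/
noncomputable def charPoly (c : ℕ → L) (m M : ℕ) : L[X] :=
  X ^ M + ∑ i ∈ Finset.range m, C (c (i + 1)) * X ^ (M - 1 - i)

theorem charPoly_tail_degree (c : ℕ → L) {m M : ℕ} (hM : 1 ≤ M) :
    (∑ i ∈ Finset.range m, C (c (i + 1)) * X ^ (M - 1 - i)).degree <
      (M : WithBot ℕ) := by
  rw [← mem_degreeLT]
  refine Submodule.sum_mem _ fun i _ => ?_
  rw [mem_degreeLT]
  exact (degree_C_mul_X_pow_le _ _).trans_lt (by exact_mod_cast (by omega : M - 1 - i < M))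

theorem charPoly_monic (c : ℕ → L) {m M : ℕ} (hM : 1 ≤ M) : (charPoly c m M).Monic :=
  monic_X_pow_add (charPoly_tail_degree c hM)

theorem natDegree_charPoly (c : ℕ → L) {m M : ℕ} (hM : 1 ≤ M) :
    (charPoly c m M).natDegree = M :=
  natDegree_eq_of_degree_eq_some (by
    rw [charPoly, degree_add_eq_left_of_degree_lt, degree_X_pow]
    rw [degree_X_pow]
    exact charPoly_tail_degree c hM)

theorem coeff_charPoly (c : ℕ → L) {m M i : ℕ} (hmM : m ≤ M) (hi : i < m) :
    (charPoly c m M).coeff (M - 1 - i) = c (i + 1) := by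
  rw [charPoly, coeff_add, coeff_X_pow, if_neg (by omega), zero_add, finsetSum_coeff,
    Finset.sum_eq_single i]
  · simp
  · intro j hj hji
    rw [Finset.mem_range] at hj
    rw [coeff_C_mul_X_pow, if_neg (by omega)]
  · intro h
    exact absurd (Finset.mem_range.mpr hi) h

/-- A solution `p` of the linear recurrence with characteristic polynomial `charPoly c m M` defines
a functional on `L[T] ⧸ (charPoly c m M)`. -/
theorem exists_functional (c : ℕ → L) {m M : ℕ} (hM : 1 ≤ M) (p : ℕ → κ)
    (hrec : ∀ r, p (M + r) + ∑ i ∈ Finset.range m,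
      algebraMap L κ (c (i + 1)) * p (M - 1 - i + r) = 0) :
    ∃ f : AdjoinRoot (charPoly c m M) →ₗ[L] κ,
      ∀ r, f (AdjoinRoot.root (charPoly c m M) ^ r) = p r := by
  let pb := AdjoinRoot.powerBasis' (charPoly_monic c (m := m) hM)
  have hdim : pb.dim = M := natDegree_charPoly c hM
  refine ⟨pb.basis.constr L fun i => p i, fun r => ?_⟩
  induction r using Nat.strong_induction_on with
  | _ r ih =>
    rcases lt_or_ge r M with hr | hr
    · have h1 : AdjoinRoot.root (charPoly c m M) ^ r = pb.basis ⟨r, by omega⟩ := by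
        rw [pb.basis_eq_pow]; rfl
      rw [h1, Module.Basis.constr_basis]
    · obtain ⟨r, rfl⟩ := Nat.exists_eq_add_of_le hr
      have h1 : AdjoinRoot.root (charPoly c m M) ^ (M + r) = - ∑ i ∈ Finset.range m,
          c (i + 1) • AdjoinRoot.root (charPoly c m M) ^ (M - 1 - i + r) := by
        have h2 : AdjoinRoot.mk (charPoly c m M) (charPoly c m M) = 0 := AdjoinRoot.mk_self
        rw [show AdjoinRoot.mk (charPoly c m M) (charPoly c m M) = AdjoinRoot.mk (charPoly c m M)
          (X ^ M + ∑ i ∈ Finset.range m, C (c (i + 1)) * X ^ (M - 1 - i)) from rfl] at h2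
        simp only [map_add, map_pow, AdjoinRoot.mk_X, map_sum, map_mul, AdjoinRoot.mk_C] at h2
        rw [pow_add, eq_neg_of_add_eq_zero_left h2, neg_mul, Finset.sum_mul]
        congr 1
        refine Finset.sum_congr rfl fun i _ => ?_
        rw [Algebra.smul_def, AdjoinRoot.algebraMap_eq, pow_add, mul_assoc]
      rw [h1, map_neg, map_sum, eq_comm, eq_neg_iff_add_eq_zero]
      rw [← hrec r]
      congr 1
      refine Finset.sum_congr rfl fun i _ => ?_
      rw [map_smul, ih _ (by omega), Algebra.smul_def]

/-- The sequence `1, T, T², T⁴, …`. -/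
def frobSeq {Q : Type*} [Monoid Q] (x : Q) : ℕ → Q
  | 0 => 1
  | j + 1 => x ^ 2 ^ j

/-- The powers `1, T, T², T⁴, …, T^{2^{e-1}}` are linearly independent modulo `F` up to the first
degree `2^e ≤ 2^N` of an additive polynomial plus a constant that is divisible by `F`. -/
theorem exists_linearIndependent_frobSeq (F : L[X]) (hF : F.natDegree ≠ 0) (N : ℕ) :
    ∃ e ≤ N, LinearIndependent L (fun i : Fin (e + 1) => frobSeq (AdjoinRoot.root F) i) ∧
      (e = N ∨ ∃ (a : Fin e → L) (b : L), F ∣ affinePoly a b) := by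
  induction N with
  | zero =>
    refine ⟨0, le_rfl, ?_, .inl rfl⟩
    have : Nontrivial (AdjoinRoot F) := AdjoinRoot.nontrivial F (by
      intro h
      exact hF (natDegree_eq_zero_iff_degree_le_zero.mpr h.le))
    have h1 : (fun i : Fin (0 + 1) => frobSeq (AdjoinRoot.root F) i) = fun _ => 1 := by
      funext i
      rw [Fin.fin_one_eq_zero i]
      rfl
    rw [h1]
    refine Fintype.linearIndependent_iff.mpr fun g hg i => ?_
    rw [Fin.sum_univ_one, smul_eq_zero] at hg
    rw [Fin.fin_one_eq_zero i]
    exact hg.resolve_right one_ne_zero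
  | succ N ih =>
    obtain ⟨e, he, hli, rfl | hrel⟩ := ih
    · by_cases hmem : frobSeq (AdjoinRoot.root F) (e + 1) ∈ Submodule.span L
        (Set.range fun i : Fin (e + 1) => frobSeq (AdjoinRoot.root F) i)
      · refine ⟨e, by omega, hli, .inr ?_⟩
        obtain ⟨a, ha⟩ := (Submodule.mem_span_range_iff_exists_fun L).mp hmem
        refine ⟨fun j => - a j.succ, - a 0, ?_⟩
        rw [← AdjoinRoot.mk_eq_zero]
        rw [Fin.sum_univ_succ] at ha
        simp only [frobSeq, Fin.val_succ, Fin.val_zero, Algebra.smul_def,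
          AdjoinRoot.algebraMap_eq] at ha
        simp only [affinePoly, map_add, map_pow, AdjoinRoot.mk_X, map_sum, map_mul,
          AdjoinRoot.mk_C, map_neg, neg_mul, Finset.sum_neg_distrib]
        rw [← ha]
        ring
      · refine ⟨e + 1, le_rfl, linearIndependent_finSucc'.mpr ⟨hli, hmem⟩, .inl rfl⟩
    · exact ⟨e, by omega, hli, .inr hrel⟩

/-- The values of a functional on `L[T] ⧸ (F)` that vanishes on `1, T, T², …, T^{2^{N-1}}` span a
space whose dimension is smaller than `deg F` by the number of these powers that are independent. -/
theorem exists_finset_span {F : L[X]} (hF : F.Monic) {N e : ℕ} (he : e ≤ N)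
    (hli : LinearIndependent L (fun i : Fin (e + 1) => frobSeq (AdjoinRoot.root F) i))
    (f : AdjoinRoot F →ₗ[L] κ) {p : ℕ → κ} (hf : ∀ r, f (AdjoinRoot.root F ^ r) = p r)
    (hp0 : p 0 = 0) (hp : ∀ j < N, p (2 ^ j) = 0) :
    ∃ s : Finset κ, s.card + (e + 1) ≤ F.natDegree ∧
      ∀ r, p r ∈ Submodule.span L (s : Set κ) := by
  classical
  have : Module.Finite L (AdjoinRoot F) := (AdjoinRoot.powerBasis' hF).finite
  have hfinQ : Module.finrank L (AdjoinRoot F) = F.natDegree := by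
    rw [(AdjoinRoot.powerBasis' hF).finrank]; rfl
  have hmem : ∀ i : Fin (e + 1), frobSeq (AdjoinRoot.root F) i ∈ LinearMap.ker f := by
    rintro ⟨i, hi⟩
    rw [LinearMap.mem_ker]
    cases i with
    | zero =>
      have := hf 0
      rwa [pow_zero, hp0] at this
    | succ j => exact (hf (2 ^ j)).trans (hp j (by omega))
  have hli' : LinearIndependent L (fun i : Fin (e + 1) => (⟨_, hmem i⟩ : LinearMap.ker f)) :=
    LinearIndependent.of_comp (LinearMap.ker f).subtype hli
  have hker : e + 1 ≤ Module.finrank L (LinearMap.ker f) := by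
    simpa using hli'.fintype_card_le_finrank
  have hrank := LinearMap.finrank_range_add_finrank_ker f
  rw [hfinQ] at hrank
  let B := Module.finBasis L (LinearMap.range f)
  refine ⟨Finset.univ.image fun i => (B i : κ), ?_, fun r => ?_⟩
  · have : (Finset.univ.image fun i => (B i : κ)).card ≤
        Module.finrank L (LinearMap.range f) := by
      simpa using Finset.card_image_le (s := Finset.univ) (f := fun i => (B i : κ))
    omega
  · have h1 := congrArg Subtype.val (B.sum_repr (⟨p r, ⟨_, hf r⟩⟩ : LinearMap.range f))
    rw [Submodule.coe_sum] at h1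
    rw [← show ((⟨p r, ⟨_, hf r⟩⟩ : LinearMap.range f) : κ) = p r from rfl, ← h1]
    refine sum_mem fun i _ => Submodule.smul_mem _ _ (Submodule.subset_span ?_)
    simp

end Recurrence

section Estimate

variable {k κ : Type*} [Field k] [Field κ] [Algebra k κ]

/-- If `charPoly c m M` divides an additive polynomial plus a constant, then the `c_i` are algebraic
over the field generated by the coefficients of the latter, of which there are at most `t`, as the
constant vanishes in the second case of `ht`. -/
theorem exists_finset_of_dvd_affinePoly [CharP κ 2] {L : IntermediateField k κ} (c : ℕ → L)
    {m M e : ℕ} (hm : 1 ≤ m) (hM : M = m ∨ M = m + 1) (hc0 : c 0 = 1) (hc : ∀ i, m < i → c i = 0)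
    (hc1 : c 1 = 0) {a : Fin e → L} {b : L} (hdvd : charPoly c m M ∣ affinePoly a b) {t : ℕ}
    (ht : e + 1 ≤ t ∨ (e ≤ t ∧ (M = m + 1 ∨ Odd m))) :
    ∃ s : Finset κ, s.card ≤ t ∧ ∀ E : IntermediateField k κ, (∀ x ∈ s, x ∈ E) →
      ∀ i, (c i : κ) ∈ algebraicClosure E κ := by
  classical
  have hM1 : 1 ≤ M := by omega
  have hmon := charPoly_monic c (m := m) hM1
  -- the constant term vanishes: either `T` divides, or all roots are summed up
  have hb : (M = m + 1 ∨ Odd m) → b = 0 := by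
    intro h
    have hL : CharP L 2 := (RingHom.charP_iff (algebraMap L κ)
      (algebraMap L κ).injective 2).mpr inferInstance
    by_cases hMm : M = m + 1
    · have h0 : (charPoly c m M).eval 0 = 0 := by
        rw [charPoly, eval_add, eval_pow, eval_X, zero_pow (by omega), zero_add, eval_finsetSum]
        refine Finset.sum_eq_zero fun i hi => ?_
        rw [Finset.mem_range] at hi
        rw [eval_mul, eval_pow, eval_X, zero_pow (by omega), mul_zero]
      have h1 := eval_eq_zero_of_dvd_of_eval_eq_zero hdvd h0
      rw [eval_affinePoly] at h1
      simpa using h1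
    · have hMm' : M = m := by tauto
      subst hMm'
      refine affinePoly_const_eq_zero_of_odd hmon hdvd ?_ ?_
      · rw [natDegree_charPoly c hM1]
        tauto
      · rw [nextCoeff_of_natDegree_pos (by rw [natDegree_charPoly c hM1]; omega),
          natDegree_charPoly c hM1]
        simpa [hc1] using coeff_charPoly c (le_refl M) hm
  refine ⟨Finset.univ.image (fun j => (a j : κ)) ∪ (if b = 0 then ∅ else {(b : κ)}), ?_, ?_⟩
  · refine (Finset.card_union_le _ _).trans ?_
    have h1 : (Finset.univ.image (fun j => (a j : κ))).card ≤ e := by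
      simpa using Finset.card_image_le (s := (Finset.univ : Finset (Fin e)))
        (f := fun j => (a j : κ))
    by_cases hb0 : b = 0
    · rw [if_pos hb0, Finset.card_empty]
      omega
    · rw [if_neg hb0, Finset.card_singleton]
      have : ¬ (M = m + 1 ∨ Odd m) := fun h => hb0 (hb h)
      have : e + 1 ≤ t := by tauto
      omega
  · intro E hE i
    have haE : ∀ j, (a j : κ) ∈ E := fun j => hE _ (by simp)
    have hbE : (b : κ) ∈ E := by
      by_cases hb0 : b = 0
      · rw [hb0]; exact zero_mem E
      · exact hE _ (by simp [hb0])
    have hcoeff : ∀ i, ((affinePoly a b).map (algebraMap L κ)).coeff i ∈ E := by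
      intro i
      have h1 : (affinePoly a b).map (algebraMap L κ) =
          (affinePoly (fun j => (⟨a j, haE j⟩ : E)) ⟨b, hbE⟩).map (algebraMap E κ) := by
        rw [affinePoly_map, affinePoly_map]
        rfl
      rw [h1, coeff_map]
      exact Subtype.property _
    rcases Nat.eq_zero_or_pos i with rfl | hi
    · rw [hc0]; exact one_mem _
    rcases lt_or_ge m i with him | him
    · rw [hc i him]; exact zero_mem _
    · have h1 := coeff_mem_algebraicClosure_of_dvd (hmon.map (algebraMap L κ))
        ((affinePoly_monic a b).map (algebraMap L κ)) (Polynomial.map_dvd _ hdvd) E hcoeff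
        (M - 1 - (i - 1))
      rw [coeff_map, coeff_charPoly c (by omega) (by omega)] at h1
      rwa [Nat.sub_add_cancel hi] at h1

/-- Let `κ` be generated by the coefficients of `c = 1 + c_2 w² + ⋯ + c_m w^m` and of a polynomial
`d` of degree less than `M ∈ {m, m + 1}`. If the coefficients of `w^0, w^1, w^2, w^4, …,
w^{2^{N-1}}` in the power series `p = d / c` vanish, then these `N + 2` equations lower the
transcendence degree by `N + 2`, for `N` in the stated range. -/
theorem trdeg_le_of_vanishing [CharP κ 2] {m M N : ℕ} (c d p : ℕ → κ) (hm : 1 ≤ m)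
    (hM : M = m ∨ M = m + 1) (hc0 : c 0 = 1) (hc : ∀ i, m < i → c i = 0)
    (hd : ∀ i, M ≤ i → d i = 0)
    (hconv : ∀ r, d r = ∑ i ∈ Finset.range (r + 1), c i * p (r - i))
    (hgen : ∀ E : IntermediateField k κ, (∀ i, c i ∈ E) → (∀ i, d i ∈ E) → E = ⊤)
    (hc1 : c 1 = 0) (hp0 : p 0 = 0) (hp : ∀ j < N, p (2 ^ j) = 0)
    (hN : N + 2 ≤ m ∨ (N + 1 ≤ m ∧ (M = m + 1 ∨ Odd m))) :
    Algebra.trdeg k κ ≤ (m + M - 2 - N : ℕ) := by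
  classical
  have hM1 : 1 ≤ M := by omega
  let L := IntermediateField.adjoin k (Set.range c)
  let c' : ℕ → L := fun i => ⟨c i, IntermediateField.subset_adjoin k _ ⟨i, rfl⟩⟩
  have hrec : ∀ r, p (M + r) + ∑ i ∈ Finset.range m,
      algebraMap L κ (c' (i + 1)) * p (M - 1 - i + r) = 0 := by
    intro r
    have h := hconv (M + r)
    rw [hd _ (by omega), Finset.sum_range_succ', hc0, one_mul, Nat.sub_zero] at h
    rw [add_comm, h]
    congr 1
    have hsub : Finset.range m ⊆ Finset.range (M + r) := by
      intro i; simp only [Finset.mem_range]; omega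
    rw [← Finset.sum_subset hsub]
    · refine Finset.sum_congr rfl fun i hi => ?_
      rw [Finset.mem_range] at hi
      rw [show M + r - (i + 1) = M - 1 - i + r by omega]
      rfl
    · intro i _ hi
      rw [Finset.mem_range] at hi
      rw [hc _ (by omega), zero_mul]
  obtain ⟨f, hf⟩ := exists_functional c' hM1 p hrec
  have hdeg : (charPoly c' m M).natDegree = M := natDegree_charPoly c' hM1
  obtain ⟨e, he, hli, hrel⟩ := exists_linearIndependent_frobSeq (charPoly c' m M) (by omega) N
  obtain ⟨s₂, hs₂, hps₂⟩ := exists_finset_span (charPoly_monic c' hM1) he hli f hf hp0 hp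
  rw [hdeg] at hs₂
  -- the `c_i` depend on few parameters: `c_2, …, c_m` if `e = N`, and `a_j`, `b` otherwise
  obtain ⟨s₁, hs₁, hs₁c⟩ : ∃ s : Finset κ, s.card ≤ m + e - N - 1 ∧
      ∀ E : IntermediateField k κ, (∀ x ∈ s, x ∈ E) → ∀ i, c i ∈ algebraicClosure E κ := by
    rcases hrel with rfl | ⟨a, b, hab⟩
    · refine ⟨(Finset.Icc 2 m).image c, ?_, ?_⟩
      · refine Finset.card_image_le.trans ?_
        rw [Nat.card_Icc]
        omega
      · intro E hE i
        have h1 : c i ∈ E := by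
          rcases Nat.eq_zero_or_pos i with rfl | hi
          · rw [hc0]; exact one_mem E
          rcases lt_or_ge m i with him | him
          · rw [hc i him]; exact zero_mem E
          rcases Nat.lt_or_ge 1 i with h1 | h1
          · exact hE _ (Finset.mem_image_of_mem c (Finset.mem_Icc.mpr ⟨h1, him⟩))
          · rw [show i = 1 by omega, hc1]; exact zero_mem E
        exact algebraMap_mem (algebraicClosure E κ) ⟨c i, h1⟩
    · exact exists_finset_of_dvd_affinePoly c' hm hM (Subtype.ext hc0)
        (fun i hi => Subtype.ext (hc i hi)) (Subtype.ext hc1) hab (by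
          rcases hN with h | ⟨h, h'⟩
          · exact .inl (by omega)
          · exact .inr ⟨by omega, h'⟩)
  let E₀ := IntermediateField.adjoin k ((s₁ ∪ s₂ : Finset κ) : Set κ)
  have hE₀ : ∀ x ∈ s₁ ∪ s₂, x ∈ E₀ := fun x hx => IntermediateField.subset_adjoin k _ hx
  let E := (algebraicClosure E₀ κ).restrictScalars k
  have hcE : ∀ i, c i ∈ E := fun i =>
    hs₁c E₀ (fun x hx => hE₀ x (Finset.mem_union_left _ hx)) i
  have hLE : ∀ x : L, (x : κ) ∈ E := by
    intro x
    have h1 : L ≤ E := IntermediateField.adjoin_le_iff.mpr (by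
      rintro _ ⟨i, rfl⟩
      exact hcE i)
    exact h1 x.2
  have hpE : ∀ r, p r ∈ E := by
    intro r
    refine Submodule.span_induction (p := fun x _ => x ∈ E) (fun x hx => ?_) (zero_mem E)
      (fun x y _ _ hx hy => add_mem hx hy) (fun a x _ hx => ?_) (hps₂ r)
    · exact algebraMap_mem (algebraicClosure E₀ κ) ⟨x, hE₀ _ (Finset.mem_union_right _ hx)⟩
    · rw [Algebra.smul_def]
      exact mul_mem (hLE a) hx
  have htop : E = ⊤ := hgen E hcE fun i => by
    rw [hconv]
    exact sum_mem fun j _ => mul_mem (hcE _) (hpE _)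
  have htop' : algebraicClosure E₀ κ = ⊤ := by
    refine top_unique fun x _ => ?_
    have : x ∈ E := htop ▸ IntermediateField.mem_top
    exact this
  refine (trdeg_le_of_isAlgebraic_adjoin htop').trans ?_
  have hcard : Cardinal.mk ((s₁ ∪ s₂ : Finset κ) : Set κ) = (s₁ ∪ s₂).card := by simp
  rw [hcard]
  have := Finset.card_union_le s₁ s₂
  exact_mod_cast (by omega : (s₁ ∪ s₂).card ≤ m + M - 2 - N)

end Estimate

/-! ### Codimension of the primes that contain the sequence -/

section Codimension

variable {n : ℕ} (P : Ideal (S n))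

/-- The map from `S_n` to the field of fractions of `S_n ⧸ P`, for a prime `P`. -/
noncomputable def toFracQuot : S n →ₐ[ZMod 2] FractionRing (S n ⧸ P) :=
  (IsScalarTower.toAlgHom (ZMod 2) (S n ⧸ P) (FractionRing (S n ⧸ P))).comp
    (Ideal.Quotient.mkₐ (ZMod 2) P)

variable {P} in
theorem toFracQuot_eq_zero {f : S n} (hf : f ∈ P) : toFracQuot P f = 0 := by
  have h : Ideal.Quotient.mk P f = 0 := Ideal.Quotient.eq_zero_iff_mem.mpr hf
  change algebraMap (S n ⧸ P) (FractionRing (S n ⧸ P)) (Ideal.Quotient.mk P f) = 0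
  rw [h, map_zero]

theorem trdeg_quotient_le_trdeg_fractionRing :
    Algebra.trdeg (ZMod 2) (S n ⧸ P) ≤ Algebra.trdeg (ZMod 2) (FractionRing (S n ⧸ P)) :=
  trdeg_le_of_injective
    (IsScalarTower.toAlgHom (ZMod 2) (S n ⧸ P) (FractionRing (S n ⧸ P)))
    (IsFractionRing.injective (S n ⧸ P) (FractionRing (S n ⧸ P)))

variable [P.IsPrime]

/-- The field of fractions of `S_n ⧸ P` is generated by the classes `u_1, …, u_n`. -/
theorem eq_top_of_forall_toFracQuot_su_mem
    (E : IntermediateField (ZMod 2) (FractionRing (S n ⧸ P)))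
    (hE : ∀ i, 1 ≤ i → i ≤ n → toFracQuot P (su n i) ∈ E) : E = ⊤ := by
  have h1 : ∀ f, toFracQuot P f ∈ E := by
    intro f
    induction f using MvPolynomial.induction_on with
    | C a => exact ((toFracQuot P).commutes a).symm ▸ E.algebraMap_mem a
    | add p q hp hq => rw [map_add]; exact add_mem hp hq
    | mul_X p i hp =>
      rw [map_mul, ← su_succ]
      exact mul_mem hp (hE _ (by omega) (by omega))
  refine top_unique fun x _ => ?_
  obtain ⟨a, b, -, rfl⟩ := IsFractionRing.div_surjective (A := S n ⧸ P) x
  obtain ⟨f, rfl⟩ := Ideal.Quotient.mk_surjective a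
  obtain ⟨g, rfl⟩ := Ideal.Quotient.mk_surjective b
  exact div_mem (h1 f) (h1 g)

theorem trdeg_le_of_su_one_mem (h1 : su n 1 ∈ P) :
    Algebra.trdeg (ZMod 2) (S n ⧸ P) ≤ (n - 1 : ℕ) := by
  classical
  let s : Finset (FractionRing (S n ⧸ P)) :=
    (Finset.Icc 2 n).image fun i => toFracQuot P (su n i)
  have htop : IntermediateField.adjoin (ZMod 2) (s : Set (FractionRing (S n ⧸ P))) = ⊤ := by
    refine eq_top_of_forall_toFracQuot_su_mem P _ fun i hi hin => ?_
    rcases hi.eq_or_lt with rfl | hi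
    · rw [toFracQuot_eq_zero h1]
      exact zero_mem _
    · exact IntermediateField.subset_adjoin _ _
        (Finset.mem_image_of_mem _ (Finset.mem_Icc.mpr ⟨hi, hin⟩))
  refine (trdeg_quotient_le_trdeg_fractionRing P).trans
    ((trdeg_le_of_isAlgebraic_adjoin (s := (s : Set (FractionRing (S n ⧸ P)))) ?_).trans ?_)
  · refine top_unique fun x _ => ?_
    have hx : x ∈ IntermediateField.adjoin (ZMod 2) (s : Set (FractionRing (S n ⧸ P))) :=
      htop ▸ IntermediateField.mem_top
    exact algebraMap_mem (algebraicClosure _ (FractionRing (S n ⧸ P)))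
      (⟨x, hx⟩ : IntermediateField.adjoin (ZMod 2) (s : Set (FractionRing (S n ⧸ P))))
  · have h2 : s.card ≤ n - 1 := by
      refine Finset.card_image_le.trans ?_
      rw [Nat.card_Icc]
      omega
    have h3 : Cardinal.mk (s : Set (FractionRing (S n ⧸ P))) = s.card := Cardinal.mk_coe_finset
    rw [h3]
    exact_mod_cast h2

/-- A prime that contains `u_1`, `u_2` and the coefficients of `w^{2^j}` for `j < N` in the quotient
of the generating series of the odd and even classes has codimension at least `N + 2`, for `N` in
the stated range. -/
theorem trdeg_le_of_coeff_pSeries_mem {m M N : ℕ} (hm : 1 ≤ m) (hn : n = m + M)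
    (hM : M = m ∨ M = m + 1) (h1 : su n 1 ∈ P) (h2 : su n 2 ∈ P)
    (hp : ∀ j < N, PowerSeries.coeff (2 ^ j) (pSeries n) ∈ P)
    (hN : N + 2 ≤ m ∨ (N + 1 ≤ m ∧ (M = m + 1 ∨ Odd m))) :
    Algebra.trdeg (ZMod 2) (S n ⧸ P) ≤ (n - 2 - N : ℕ) := by
  have : CharP (FractionRing (S n ⧸ P)) 2 :=
    charP_of_injective_algebraMap (algebraMap (ZMod 2) (FractionRing (S n ⧸ P))).injective 2
  refine (trdeg_quotient_le_trdeg_fractionRing P).trans ?_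
  subst hn
  refine trdeg_le_of_vanishing (fun i => toFracQuot P (su (m + M) (2 * i)))
    (fun i => toFracQuot P (su (m + M) (2 * i + 1)))
    (fun i => toFracQuot P (PowerSeries.coeff i (pSeries (m + M)))) hm hM ?_ ?_ ?_ ?_ ?_ ?_ ?_ ?_ hN
  · simp [su]
  · intro i hi
    rw [su_eq_zero (by omega), map_zero]
  · intro i hi
    rw [su_eq_zero (by omega), map_zero]
  · intro r
    have h := congrArg (PowerSeries.coeff r) (cSeries_mul_pSeries (m + M))
    rw [PowerSeries.coeff_mul, Finset.Nat.sum_antidiagonal_eq_sum_range_succ_mk] at h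
    simp only [cSeries, dSeries, PowerSeries.coeff_mk] at h
    simp only [h, map_sum, map_mul]
  · intro E hc hd
    refine eq_top_of_forall_toFracQuot_su_mem P E fun i _ _ => ?_
    rcases Nat.even_or_odd' i with ⟨j, rfl | rfl⟩
    · exact hc j
    · exact hd j
  · exact toFracQuot_eq_zero h2
  · simp only [coeff_zero_pSeries]
    exact toFracQuot_eq_zero h1
  · exact fun j hj => toFracQuot_eq_zero (hp j hj)

end Codimension

/-! ### The regular sequence -/

section Regular

theorem constantCoeff_su (n i : ℕ) (hi : i ≠ 0) : MvPolynomial.constantCoeff (su n i) = 0 := by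
  rw [su, if_neg hi]
  split_ifs <;> simp

theorem constantCoeff_coeff_pSeries (n r : ℕ) :
    MvPolynomial.constantCoeff (PowerSeries.coeff r (pSeries n)) = 0 := by
  have hd : PowerSeries.map MvPolynomial.constantCoeff (dSeries n) = 0 := by
    ext i
    rw [PowerSeries.coeff_map, dSeries, PowerSeries.coeff_mk, constantCoeff_su n _ (by omega),
      map_zero]
  rw [← PowerSeries.coeff_map, pSeries, map_mul, hd, zero_mul, map_zero]

/-- The range in which `trdeg_le_of_coeff_pSeries_mem` applies is `N < h(n)`. -/
theorem range_of_lt_hTable {n N : ℕ} (hn : 1 ≤ n) (hN : N < hTable n) :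
    ∃ m M : ℕ, 1 ≤ m ∧ n = m + M ∧ (M = m ∨ M = m + 1) ∧
      (N + 2 ≤ m ∨ (N + 1 ≤ m ∧ (M = m + 1 ∨ Odd m))) := by
  refine ⟨n / 2, (n + 1) / 2, ?_⟩
  rw [Nat.odd_iff]
  have h : (n - 1) % 8 < 8 := Nat.mod_lt _ (by norm_num)
  unfold hTable at hN
  interval_cases hr : (n - 1) % 8 <;> simp only at hN <;> omega

end Regular

end SubtleSW

open SubtleSW in
theorem theorem7p4 (k : Type*) [Field k] (hchar : (2 : k) ≠ 0) (hsqrt : IsSquare (-1 : k))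
    (n : ℕ) (hn : 1 ≤ n) :
    RingTheory.Sequence.IsRegular (SubtleSW.S n)
      (SubtleSW.gamma k n (SubtleSW.u k n 1) ::
        (List.range (SubtleSW.hTable n)).map
          (fun j => SubtleSW.gamma k n (SubtleSW.theta k n j))) := by
  have hzero : gamma k n (theta k n 0) = su n 2 := gamma_u k n 2
  have h2n : ∀ j, j < hTable n → 2 ≤ n := by
    intro j hj
    obtain ⟨m, M, h1, h2, h3, -⟩ := range_of_lt_hTable hn hj
    omega
  refine ⟨isWeaklyRegular_of_trdeg_le _ fun i hi P hP hmem => ?_, ?_⟩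
  · rw [List.length_cons, List.length_map, List.length_range] at hi
    have h1 : su n 1 ∈ P := by
      rw [← gamma_u k]
      exact hmem _ (by simp)
    rcases i with _ | N
    · exact ⟨n - 1, by omega, trdeg_le_of_su_one_mem P h1⟩
    · have hθ : ∀ j ≤ N, gamma k n (theta k n j) ∈ P := by
        intro j hj
        refine hmem _ ?_
        rw [List.take_succ_cons, ← List.map_take, List.take_range]
        refine List.mem_cons_of_mem _ (List.mem_map.mpr ⟨j, List.mem_range.mpr ?_, rfl⟩)
        omega
      obtain ⟨m, M, hm, hmM, hM, hN⟩ := range_of_lt_hTable hn (N := N) (by omega)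
      refine ⟨n - 2 - N, by omega,
        trdeg_le_of_coeff_pSeries_mem P hm hmM hM h1 (hzero ▸ hθ 0 (by omega)) ?_ hN⟩
      intro j hj
      rw [← gamma_theta_succ k n (by omega)]
      exact hθ _ (by omega)
  · -- all terms vanish at the origin
    intro htop
    rw [smul_eq_mul, Ideal.mul_top] at htop
    have hle : Ideal.ofList (gamma k n (u k n 1) ::
        (List.range (hTable n)).map (fun j => gamma k n (theta k n j))) ≤
        RingHom.ker (MvPolynomial.constantCoeff (σ := Fin n) (R := ZMod 2)) := by
      refine Ideal.span_le.mpr fun f hf => ?_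
      change MvPolynomial.constantCoeff f = 0
      rcases List.mem_cons.mp hf with rfl | hf
      · rw [gamma_u, constantCoeff_su n 1 one_ne_zero]
      · obtain ⟨j, hj, rfl⟩ := List.mem_map.mp hf
        cases j with
        | zero => rw [hzero, constantCoeff_su n 2 two_ne_zero]
        | succ j =>
          rw [gamma_theta_succ k n (h2n _ (List.mem_range.mp hj)), constantCoeff_coeff_pSeries]
    rw [← htop] at hle
    exact RingHom.ker_ne_top _ (top_unique hle)
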